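/- **Setting.** Let $(\Omega,\mathcal A,\mu)$ be a probability space and $T:\Omega\to\Omega$ a measurable map for which $\mu$ is invariant and mixing, i.e. $\mu(A\cap T^{-n}B)\to\mu(A)\mu(B)$ for all $A,B\in\mathcal A$. Let $\widehat T:\mathcal L^1\to\mathcal L^1$ be its transfer operator, i.e. the operator determined by $\int \widehat Tf\cdot g\,d\mu=\int f\cdot (g\circ T)\,d\mu$ for all $f\in\mathcal L^1$, $g\in\mathcal L^\infty$. Let $\mathcal F$ be a complex Banach algebra, with respect to a norm $\|\cdot\|$, of (classes modulo $\mu$-a.e. equality of) complex-valued measurable functions on $\Omega$ with pointwise multiplication. The system $(\Omega,\mathcal A,T,\mu,\mathcal F,\|\cdot\|)$ has *Property $\mathfrak C$* if, in addition, $\mathcal F$ contains the constants; $|f|_\infty\le\|f\|$ for all $f\in\mathcal F$; $\widehat T$ maps $\mathcal F$ to $\mathcal F$ and is bounded with respect to $\|\cdot\|$; and $\widehat T$ has a spectral gap on $\mathcal F$, i.e. $\widehat T|_{\mathcal F}=\lambda P+N$ with $\lambda\in\mathbb C$ and bounded linear operators $P,N$ on $\mathcal F$ such that $P^2=P$, $\dim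 \operatorname{Im}P=1$, $PN=NP=0$, and the spectral radius of $N$ is smaller than $|\lambda|$. Let $\chi:\Omega\to\mathbb R_{\ge0}$ be measurable. The system $(\Omega,\mathcal A,T,\mu,\mathcal F,\|\cdot\|,\chi)$ has *Property $\mathfrak D$* if it has Property $\mathfrak C$ and there are constants $K_1,K_2>0$ such that for all $\ell>0$ the functions $\chi\cdot\mathbb 1_{\{\chi\le\ell\}}$ and $\mathbb 1_{\{\chi>\ell\}}$ belong to $\mathcal F$, with $$\|\chi\cdot\mathbb 1_{\{\chi\le\ell\}}\|\le K_1\ell,\qquad \|\mathbb 1_{\{\chi>\ell\}}\|\le K_2 .$$ Let $F(x)=\mu(\chi\le x)$ be the distribution function of $\chi$. For $n,b\in\mathbb N_0$ let $\mathsf S_n^{b}\chi=\sum_{k=b}^{n-1}\chi\circ T^{\sigma(k)}$, where $\sigma$ is a (pointwise chosen) permutation of $\{0,\dots,n-1\}$ with $\chi\circ T^{\sigma(0)}\ge\dots\ge\chi\circ T^{\sigma(n-1)}$. For real $x$ let $\lceil x\rceil$ be the least non-negative integer $\ge x$. **Theorem 1.2.** Let $(\Omega,\mathcal A,T,\mu,\mathcal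 F,\|\cdot\|,\chi)$ have Property $\mathfrak D$. Then there is a constant $W>0$ such that the following holds for every $0<\epsilon<1/4$ and every sequence $(f_n)$ of positive reals with $f_n\to\infty$ (so $W$ depends neither on $\epsilon$ nor on $(f_n)$). Set $$a_n=n\,(1-F(f_n)),\qquad d_n=n\int_0^{f_n}x\,dF(x),$$ and suppose that $d_n>0$ for all sufficiently large $n$ (equivalently, $\chi$ is not $\mu$-a.e. zero) and that $$\lim_{n\to\infty}\frac{f_n}{d_n}\cdot\max\left\{a_n^{1/2+\epsilon}(\log\log n)^{1/2-\epsilon},\ \log n\right\}=0 .$$ Then, with $$b_n=\left\lceil a_n+W\cdot\max\left\{a_n^{1/2+\epsilon}(\log\log n)^{1/2-\epsilon},\ \log\log n\right\}\right\rceil ,$$ where for $n\le 2$ any real values may be used for the undefined expressions, we have $$\lim_{n\to\infty}\frac{\mathsf S_n^{b_n}\chi}{d_n}=1\qquad \mu\text{-a.s.}$$ -/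

import Mathlib

open MeasureTheory ProbabilityTheory Filter Topology
open scoped ENNReal NNReal

/-- `μ` is (strongly) mixing under `T`:
`μ (A ∩ T⁻ⁿ B) → μ A * μ B` for all measurable sets `A`, `B`. -/
def IsMixing {Ω : Type*} [MeasurableSpace Ω] (T : Ω → Ω) (μ : Measure Ω) : Prop :=
  ∀ A B : Set Ω, MeasurableSet A → MeasurableSet B →
    Tendsto (fun n : ℕ => μ (A ∩ T^[n] ⁻¹' B)) atTop (𝓝 (μ A * μ B))

/-- `That` is the transfer operator of `T` on `L¹(μ)`, i.e. the (unique) operator with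
`∫ (That f) * g dμ = ∫ f * (g ∘ T) dμ` for all `f ∈ L¹` and `g ∈ L^∞`. -/
def IsTransferOperator {Ω : Type*} [MeasurableSpace Ω] (T : Ω → Ω) (μ : Measure Ω)
    (That : Lp ℂ 1 μ →L[ℂ] Lp ℂ 1 μ) : Prop :=
  ∀ (f : Lp ℂ 1 μ) (g : Ω → ℂ), MemLp g ∞ μ →
    ∫ x, That f x * g x ∂μ = ∫ x, f x * g (T x) ∂μ

/-- A bounded operator `U` on a complex Banach space has a spectral gap: `U = z P + N` with a
projection `P` of rank one, `P N = N P = 0` and spectral radius of `N` smaller than `|z|`. -/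
def HasSpectralGap {F : Type*} [NormedAddCommGroup F] [NormedSpace ℂ F]
    (U : F →L[ℂ] F) : Prop :=
  ∃ (z : ℂ) (P N : F →L[ℂ] F),
    U = z • P + N ∧
    P ∘L P = P ∧ Module.finrank ℂ (LinearMap.range (P : F →ₗ[ℂ] F)) = 1 ∧
    spectralRadius ℂ N < ‖z‖₊ ∧
    P ∘L N = 0 ∧ N ∘L P = 0

/-- The injective linear map `ι` realizes the Banach algebra `F` (with its own norm) as an algebra
of (almost everywhere classes of) measurable complex functions, with pointwise product, which
contains the constants (as `ι 1 = 1`), and whose norm dominates the essential supremum. -/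
structure IsFunctionAlgebra {Ω : Type*} [MeasurableSpace Ω] (μ : Measure Ω)
    {F : Type*} [NormedCommRing F] [NormedAlgebra ℂ F]
    (ι : F →ₗ[ℂ] (Ω →ₘ[μ] ℂ)) : Prop where
  injective : Function.Injective ι
  map_one : ι 1 = 1
  map_mul : ∀ h k : F, ι (h * k) = ι h * ι k
  ae_norm_le : ∀ h : F, ∀ᵐ x ∂μ, ‖ι h x‖ ≤ ‖h‖

/-- The inclusion of `F` in `L¹(μ)`; it exists as the elements of `F` are essentially bounded. -/
noncomputable def IsFunctionAlgebra.toL1 {Ω : Type*} [MeasurableSpace Ω] {μ : Measure Ω} [IsFiniteMeasure μ]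
    {F : Type*} [NormedCommRing F] [NormedAlgebra ℂ F]
    {ι : F →ₗ[ℂ] (Ω →ₘ[μ] ℂ)} (hι : IsFunctionAlgebra μ ι) (h : F) : Lp ℂ 1 μ :=
  ⟨ι h, Lp.mem_Lp_iff_memLp.2
    (MemLp.of_bound (ι h).aestronglyMeasurable ‖h‖ (hι.ae_norm_le h))⟩

/-- Property C of `(Ω, T, μ, F, ‖·‖)`, where `F` is included in the measurable functions by `ι`. -/
structure PropertyC {Ω : Type*} [MeasurableSpace Ω] (T : Ω → Ω) (μ : Measure Ω)
    [IsProbabilityMeasure μ] {F : Type*} [NormedCommRing F] [NormedAlgebra ℂ F] [CompleteSpace F]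
    (ι : F →ₗ[ℂ] (Ω →ₘ[μ] ℂ)) : Prop where
  /-- `μ` is `T`-invariant -/
  measurePreserving : MeasurePreserving T μ μ
  mixing : IsMixing T μ
  isFunctionAlgebra : IsFunctionAlgebra μ ι
  /-- the transfer operator restricts to a bounded operator `U` of `F`, with a spectral gap -/
  transfer : ∃ That : Lp ℂ 1 μ →L[ℂ] Lp ℂ 1 μ, IsTransferOperator T μ That ∧
    ∃ U : F →L[ℂ] F,
      (∀ h : F, That (isFunctionAlgebra.toL1 h) = isFunctionAlgebra.toL1 (U h)) ∧
      HasSpectralGap U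

/-- The truncation `χ * 1_{χ ≤ ℓ}`. -/
noncomputable def truncate {Ω : Type*} (χ : Ω → ℝ) (ℓ : ℝ) : Ω → ℝ :=
  {x | χ x ≤ ℓ}.indicator χ

/-- Property D of `(Ω, T, μ, F, ‖·‖, χ)`. The observable `χ` may be unbounded; its truncations
`χ * 1_{χ ≤ ℓ}` and the indicators `1_{χ > ℓ}` are in `F`, with the stated bounds of their norms. -/
structure PropertyD {Ω : Type*} [MeasurableSpace Ω] (T : Ω → Ω) (μ : Measure Ω)
    [IsProbabilityMeasure μ] {F : Type*} [NormedCommRing F] [NormedAlgebra ℂ F] [CompleteSpace F]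
    (ι : F →ₗ[ℂ] (Ω →ₘ[μ] ℂ)) (χ : Ω → ℝ) : Prop where
  propertyC : PropertyC T μ ι
  measurable : Measurable χ
  nonneg : ∀ x, 0 ≤ χ x
  norm_truncate_le : ∃ K₁ : ℝ, 0 < K₁ ∧ ∀ ℓ : ℝ, 0 < ℓ →
    ∃ h : F, (∀ᵐ x ∂μ, ι h x = (truncate χ ℓ x : ℂ)) ∧ ‖h‖ ≤ K₁ * ℓ
  norm_indicator_le : ∃ K₂ : ℝ, 0 < K₂ ∧ ∀ ℓ : ℝ, 0 < ℓ →
    ∃ h : F, (∀ᵐ x ∂μ, ι h x = {y | ℓ < χ y}.indicator (fun _ => (1 : ℂ)) x) ∧ ‖h‖ ≤ K₂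

/-- A permutation `σ` of `{0, …, n-1}` with
`χ (T^{σ 0} x) ≥ χ (T^{σ 1} x) ≥ … ≥ χ (T^{σ (n-1)} x)`. -/
noncomputable def orderPerm {Ω : Type*} (T : Ω → Ω) (χ : Ω → ℝ) (n : ℕ) (x : Ω) :
    Equiv.Perm (Fin n) :=
  Tuple.sort (fun i : Fin n => -χ (T^[i] x))

/-- The trimmed Birkhoff sum `∑_{k=b}^{n-1} χ ∘ T^{σ k}`, i.e. the sum of the first `n` terms
`χ, χ ∘ T, …, χ ∘ T^{n-1}` without the `b` largest ones (it is `0` if `b ≥ n`). -/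
noncomputable def trimmedSum {Ω : Type*} (T : Ω → Ω) (χ : Ω → ℝ) (n b : ℕ) (x : Ω) : ℝ :=
  ∑ k ∈ Finset.univ.filter (fun k : Fin n => b ≤ (k : ℕ)), χ (T^[orderPerm T χ n x k] x)

theorem antitone_orderPerm {Ω : Type*} (T : Ω → Ω) (χ : Ω → ℝ) (n : ℕ) (x : Ω) :
    Antitone (fun k : Fin n => χ (T^[orderPerm T χ n x k] x)) := by
  intro i j hij
  have := Tuple.monotone_sort (fun i : Fin n => -χ (T^[i] x)) hij
  simp only [Function.comp_apply, neg_le_neg_iff] at this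
  exact this

/-- The trimmed sum does not depend on the choice of the ordering permutation. -/
theorem trimmedSum_eq {Ω : Type*} (T : Ω → Ω) (χ : Ω → ℝ) (n b : ℕ) (x : Ω)
    (σ : Equiv.Perm (Fin n)) (hσ : Antitone (fun k : Fin n => χ (T^[σ k] x))) :
    trimmedSum T χ n b x = ∑ k ∈ Finset.univ.filter (fun k : Fin n => b ≤ (k : ℕ)), χ (T^[σ k] x) := by
  have h := Tuple.unique_monotone (f := fun i : Fin n => -χ (T^[i] x))
    (σ := orderPerm T χ n x) (τ := σ)
    (fun i j hij => neg_le_neg (antitone_orderPerm T χ n x hij))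
    (fun i j hij => neg_le_neg (hσ hij))
  refine Finset.sum_congr rfl fun k _ => ?_
  simpa using congrFun h k

/-- The distribution function `F x = μ (χ ≤ x)` of `χ`. -/
noncomputable def distFun {Ω : Type*} [MeasurableSpace Ω] (μ : Measure Ω) (χ : Ω → ℝ) :
    StieltjesFunction ℝ :=
  cdf (μ.map χ)

/-- `a_n = n (1 - F (f_n))`. -/
noncomputable def aSeq {Ω : Type*} [MeasurableSpace Ω] (μ : Measure Ω) (χ : Ω → ℝ)
    (f : ℕ → ℝ) (n : ℕ) : ℝ :=
  n * (1 - distFun μ χ (f n))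

/-- `d_n = n ∫_0^{f_n} x dF(x)`. -/
noncomputable def dSeq {Ω : Type*} [MeasurableSpace Ω] (μ : Measure Ω) (χ : Ω → ℝ)
    (f : ℕ → ℝ) (n : ℕ) : ℝ :=
  n * ∫ x in Set.Icc 0 (f n), x ∂(distFun μ χ).measure

/-!
If `b n` is at least the number of exceedances of the level `f n` among the first `n` terms, then
the trimmed sum and the Birkhoff sum of `truncate χ (f n)` differ by at most `f n` times the surplus
of `b n`. So it is enough to prove a strong law for the truncated sums and to bound the fluctuations
of the number of exceedances around its mean `a n`.

Both rest on a Bernstein inequality. By duality, `∫ ∏ i < n, (1 + t * G ∘ T^i)` is the integral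
of the `n`-th iterate of the perturbed transfer operator `h ↦ U ((1 + t • g) * h)` applied to `1`;
the spectral gap bounds it by `exp (n * (t * ∫ G + C * t ^ 2 * ∫ G))` with the mean `∫ G`, rather
than just the norm of `g`, in the quadratic term.

For the truncated sums Borel–Cantelli applies directly, as `log n = o (d n / f n)`. For the counts
the allowed deviation is only of order `log log n` when `a n` is small, and the tail probabilities
are not summable over `n`. But the counts are monotone in both `n` and the level, so the natural
numbers can be partitioned into cells on which the means are nearly constant and two tail estimates
suffice, and the probabilities are summable over the cells.
-/

section FunctionAlgebra

variable {Ω : Type*} [MeasurableSpace Ω] {T : Ω → Ω} {μ : Measure Ω}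
  {F : Type*} [NormedCommRing F] [NormedAlgebra ℂ F] {ι : F →ₗ[ℂ] (Ω →ₘ[μ] ℂ)}

namespace IsFunctionAlgebra

theorem memLp_top (hι : IsFunctionAlgebra μ ι) (h : F) : MemLp (ι h) ∞ μ :=
  memLp_top_of_bound (ι h).aestronglyMeasurable ‖h‖ (hι.ae_norm_le h)

theorem coe_one (hι : IsFunctionAlgebra μ ι) : ∀ᵐ x ∂μ, ι 1 x = 1 := by
  rw [hι.map_one]
  exact AEEqFun.coeFn_one

variable [IsFiniteMeasure μ]

theorem integrable (hι : IsFunctionAlgebra μ ι) (h : F) : Integrable (ι h) μ :=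
  (hι.memLp_top h).integrable le_top

theorem eq_of_forall_setIntegral_eq (hι : IsFunctionAlgebra μ ι) {h k : F}
    (hhk : ∀ s, MeasurableSet s → ∫ x in s, ι h x ∂μ = ∫ x in s, ι k x ∂μ) : h = k :=
  hι.injective <| AEEqFun.ext <|
    (hι.integrable h).ae_eq_of_forall_setIntegral_eq _ _ (hι.integrable k) fun s hs _ => hhk s hs

/-- The integral, as a bounded functional on the function algebra. -/
noncomputable def integralCLM (hι : IsFunctionAlgebra μ ι) : F →L[ℂ] ℂ :=
  LinearMap.mkContinuous
    { toFun := fun h => ∫ x, ι h x ∂μ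
      map_add' := fun h k => by
        rw [map_add, integral_congr_ae (AEEqFun.coeFn_add _ _)]
        exact integral_add (hι.integrable h) (hι.integrable k)
      map_smul' := fun c h => by
        rw [map_smul, integral_congr_ae (AEEqFun.coeFn_smul _ _)]
        exact integral_const_mul c _ }
    (μ.real Set.univ)
    (fun h => (norm_integral_le_of_norm_le_const (hι.ae_norm_le h)).trans_eq (mul_comm _ _))

theorem integralCLM_apply (hι : IsFunctionAlgebra μ ι) (h : F) :
    hι.integralCLM h = ∫ x, ι h x ∂μ := rfl

theorem integralCLM_one [IsProbabilityMeasure μ] (hι : IsFunctionAlgebra μ ι) :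
    hι.integralCLM 1 = 1 := by
  rw [hι.integralCLM_apply, integral_congr_ae hι.coe_one]
  simp

end IsFunctionAlgebra

/-- `U` is the restriction to the function algebra `F` of the transfer operator of `T`, expressed
by the duality which characterizes the latter. -/
def IsTransferOn (T : Ω → Ω) (ι : F →ₗ[ℂ] (Ω →ₘ[μ] ℂ)) (U : F →L[ℂ] F) : Prop :=
  ∀ (h : F) (w : Ω → ℂ), MemLp w ∞ μ → ∫ x, ι (U h) x * w x ∂μ = ∫ x, ι h x * w (T x) ∂μ

theorem IsTransferOperator.isTransferOn [IsFiniteMeasure μ] {That : Lp ℂ 1 μ →L[ℂ] Lp ℂ 1 μ}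
    (hThat : IsTransferOperator T μ That) (hι : IsFunctionAlgebra μ ι) {U : F →L[ℂ] F}
    (hU : ∀ h : F, That (hι.toL1 h) = hι.toL1 (U h)) : IsTransferOn T ι U := by
  intro h w hw
  have := hThat (hι.toL1 h) w hw
  rwa [hU] at this

namespace IsTransferOn

variable {U : F →L[ℂ] F}

theorem iterate (hU : IsTransferOn T ι U) (hT : MeasurePreserving T μ μ) (n : ℕ) :
    IsTransferOn T^[n] ι (U ^ n) := by
  induction n with
  | zero => exact fun h w _ => by simp
  | succ n ih =>
    intro h w hw
    rw [pow_succ', mul_apply_eq_comp, hU _ _ hw,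
      ih h (fun x => w (T x)) (hw.comp_measurePreserving hT)]
    simp only [Function.iterate_succ_apply']

theorem setIntegral_eq [IsFiniteMeasure μ] (hU : IsTransferOn T ι U) (hT : Measurable T) (h : F)
    {s : Set Ω} (hs : MeasurableSet s) :
    ∫ x in s, ι (U h) x ∂μ = ∫ x in T ⁻¹' s, ι h x ∂μ := by
  have hw : MemLp (s.indicator (fun _ => (1 : ℂ))) ∞ μ := (memLp_const 1).indicator hs
  classical
  rw [← integral_indicator hs, ← integral_indicator (hT hs)]
  simpa only [Set.indicator_apply, Set.mem_preimage, mul_ite, mul_one, mul_zero] using hU h _ hw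

theorem integralCLM_apply [IsFiniteMeasure μ] (hU : IsTransferOn T ι U)
    (hι : IsFunctionAlgebra μ ι) (h : F) : hι.integralCLM (U h) = hι.integralCLM h := by
  simpa [hι.integralCLM_apply] using hU h (fun _ => 1) (memLp_const 1)

theorem map_one [IsFiniteMeasure μ] (hU : IsTransferOn T ι U) (hι : IsFunctionAlgebra μ ι)
    (hT : MeasurePreserving T μ μ) : U 1 = 1 := by
  have hreal : ∀ s : Set Ω, ∫ x in s, ι 1 x ∂μ = μ.real s := fun s => by
    rw [integral_congr_ae (ae_restrict_of_ae hι.coe_one)]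
    simp
  refine hι.eq_of_forall_setIntegral_eq fun s hs => ?_
  rw [hU.setIntegral_eq hT.measurable 1 hs, hreal, hreal,
    hT.measureReal_preimage hs.nullMeasurableSet]

/-- By duality `z ^ n` times the integral of an eigenvector over a set is the integral of the
eigenvector over an iterated preimage of the set, hence bounded in `n`. -/
theorem norm_eigenvalue_le_one [IsProbabilityMeasure μ] (hU : IsTransferOn T ι U)
    (hι : IsFunctionAlgebra μ ι) (hT : MeasurePreserving T μ μ) {z : ℂ} {v : F} (hv : v ≠ 0)
    (hz : U v = z • v) : ‖z‖ ≤ 1 := by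
  by_contra! hlt
  refine hv (hι.eq_of_forall_setIntegral_eq fun s hs => ?_)
  have hpow : ∀ n : ℕ, (U ^ n) v = z ^ n • v := by
    intro n
    induction n with
    | zero => simp
    | succ n ih => rw [pow_succ', mul_apply_eq_comp, ih, map_smul, hz, smul_smul, pow_succ]
  have hbound : ∀ n : ℕ, ‖z‖ ^ n * ‖∫ x in s, ι v x ∂μ‖ ≤ ‖v‖ := by
    intro n
    have hdual : ∫ x in T^[n] ⁻¹' s, ι v x ∂μ = z ^ n * ∫ x in s, ι v x ∂μ := by
      rw [← (hU.iterate hT n).setIntegral_eq (hT.iterate n).measurable v hs, hpow, map_smul,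
        ← integral_const_mul]
      exact integral_congr_ae (ae_restrict_of_ae (AEEqFun.coeFn_smul _ _))
    rw [← norm_pow, ← norm_mul, ← hdual]
    calc ‖∫ x in T^[n] ⁻¹' s, ι v x ∂μ‖ ≤ ‖v‖ * μ.real (T^[n] ⁻¹' s) :=
          norm_setIntegral_le_of_norm_le_const_ae' (measure_lt_top _ _)
            ((hι.ae_norm_le v).mono fun _ hx _ => hx)
      _ ≤ ‖v‖ := mul_le_of_le_one_right (norm_nonneg _) measureReal_le_one
  have hzero : ∫ x in s, ι v x ∂μ = 0 := by
    by_contra hne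
    obtain ⟨n, hn⟩ := (((tendsto_pow_atTop_atTop_of_one_lt hlt).atTop_mul_const
      (norm_pos_iff.2 hne)).eventually_gt_atTop ‖v‖).exists
    exact (hbound n).not_gt hn
  rw [hzero, map_zero, integral_congr_ae (ae_restrict_of_ae AEEqFun.coeFn_zero)]
  simp

end IsTransferOn

/-- The element `g` of the function algebra is the class of the real function `G`. -/
def Represents (ι : F →ₗ[ℂ] (Ω →ₘ[μ] ℂ)) (g : F) (G : Ω → ℝ) : Prop :=
  ∀ᵐ x ∂μ, ι g x = (G x : ℂ)

namespace Represents

variable {g : F} {G : Ω → ℝ}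

theorem const_smul (hG : Represents ι g G) (c : ℝ) :
    Represents ι ((c : ℂ) • g) (fun x => c * G x) := by
  unfold Represents
  rw [map_smul]
  filter_upwards [hG, AEEqFun.coeFn_smul (c : ℂ) (ι g)] with x hx hc
  rw [hc, Pi.smul_apply, hx, smul_eq_mul, Complex.ofReal_mul]

theorem one_add (hG : Represents ι g G) (hι : IsFunctionAlgebra μ ι) :
    Represents ι (1 + g) (fun x => 1 + G x) := by
  unfold Represents
  rw [map_add]
  filter_upwards [hG, hι.coe_one, AEEqFun.coeFn_add (ι 1) (ι g)] with x hx h1 hadd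
  rw [hadd, Pi.add_apply, hx, h1, Complex.ofReal_add, Complex.ofReal_one]

theorem aestronglyMeasurable (hG : Represents ι g G) : AEStronglyMeasurable G μ := by
  refine (Complex.continuous_re.comp_aestronglyMeasurable (ι g).aestronglyMeasurable).congr ?_
  filter_upwards [hG] with x hx
  simp [hx]

theorem integralCLM_eq [IsFiniteMeasure μ] (hG : Represents ι g G) (hι : IsFunctionAlgebra μ ι) :
    hι.integralCLM g = ((∫ x, G x ∂μ : ℝ) : ℂ) := by
  rw [hι.integralCLM_apply, integral_congr_ae hG, integral_complex_ofReal]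

end Represents

end FunctionAlgebra

section SpectralGap

variable {E : Type*} [NormedAddCommGroup E] [NormedSpace ℂ E] [CompleteSpace E] {N U : E →L[ℂ] E}

theorem bijective_sub_of_spectralRadius_lt_one (hN : spectralRadius ℂ N < 1) :
    Function.Bijective fun v => v - N v := by
  have hmem : (1 : ℂ) ∈ resolventSet ℂ N :=
    spectrum.mem_resolventSet_of_spectralRadius_lt (by simpa using hN)
  rw [spectrum.mem_resolventSet_iff, map_one] at hmem
  exact ContinuousLinearMap.isUnit_iff_bijective.1 hmem

/-- Let `U = z P + N`. By hypothesis `|z| ≤ 1`, so that `1 - N` is bijective. Injectivity and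
`U e = e` force `P e = e` and `z = 1`; surjectivity and the invariance of `I` force `I ∘ P = I`. -/
theorem HasSpectralGap.exists_eq_smul_add (hgap : HasSpectralGap U)
    (hle : ∀ (z : ℂ) (v : E), v ≠ 0 → U v = z • v → ‖z‖ ≤ 1) {e : E} (he : U e = e)
    {I : E →L[ℂ] ℂ} (hIe : I e = 1) (hIU : ∀ v, I (U v) = I v) :
    ∃ N : E →L[ℂ] E, spectralRadius ℂ N < 1 ∧ ∀ v, U v = I v • e + N v := by
  obtain ⟨z, P, N, hUPN, hPP, hrank, hr, hPN, hNP⟩ := hgap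
  replace hUPN : ∀ v, U v = z • P v + N v := DFunLike.congr_fun hUPN
  replace hPP : ∀ v, P (P v) = P v := DFunLike.congr_fun hPP
  replace hPN : ∀ v, P (N v) = 0 := DFunLike.congr_fun hPN
  replace hNP : ∀ v, N (P v) = 0 := DFunLike.congr_fun hNP
  have hz_le : ‖z‖ ≤ 1 := by
    obtain ⟨⟨_, u, rfl⟩, hne, -⟩ := finrank_eq_one_iff'.1 hrank
    refine hle z (P u) (fun h => hne (Subtype.ext h)) ?_
    rw [hUPN, hPP, hNP, add_zero]
  have hN : spectralRadius ℂ N < 1 := hr.trans_le (by exact_mod_cast hz_le)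
  obtain ⟨hinj, hsurj⟩ := bijective_sub_of_spectralRadius_lt_one hN
  have hzPe : z • P e = e := by
    refine hinj ?_
    simp only [map_smul, hNP, smul_zero, sub_zero]
    exact eq_sub_of_add_eq ((hUPN e).symm.trans he)
  have hPe : P e = e := by rw [← hzPe, map_smul, hPP]
  have hz : z = 1 := by simpa [hPe, hIe] using congrArg I hzPe
  have hIP : ∀ v, I (P v) = I v := by
    intro v
    obtain ⟨u, hu : u - N u = v - P v⟩ := hsurj (v - P v)
    have hPu : P u = 0 := by simpa [hPN, hPP] using congrArg P hu
    have hUu : U u = N u := by rw [hUPN, hPu, smul_zero, zero_add]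
    have h := congrArg I hu
    rw [← hUu, map_sub, map_sub, hIU, sub_self] at h
    exact (sub_eq_zero.1 h.symm).symm
  have hPI : ∀ v, P v = I v • e := by
    intro v
    have hne : (⟨e, e, hPe⟩ : LinearMap.range (P : E →ₗ[ℂ] E)) ≠ 0 := fun h => by
      have h0 : e = 0 := congrArg Subtype.val h
      simp [h0] at hIe
    obtain ⟨c, hc⟩ := (finrank_eq_one_iff_of_nonzero' _ hne).1 hrank ⟨P v, v, rfl⟩
    have hc : c • e = P v := congrArg Subtype.val hc
    rw [← hIP v, ← hc, map_smul, hIe, smul_eq_mul, mul_one]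
  exact ⟨N, hN, fun v => by rw [hUPN, hz, one_smul, hPI]⟩

theorem exists_norm_pow_le_of_spectralRadius_lt {ρ : ℝ≥0} (hN : spectralRadius ℂ N < ρ) :
    ∃ p : ℕ, 0 < p ∧ ‖N ^ p‖ ≤ (ρ : ℝ) ^ p := by
  have hlim := spectrum.pow_nnnorm_pow_one_div_tendsto_nhds_spectralRadius N
  obtain ⟨p, hlt, hp⟩ := ((hlim.eventually_lt_const hN).and (eventually_gt_atTop 0)).exists
  refine ⟨p, hp, ?_⟩
  rw [one_div, ENNReal.rpow_inv_lt_iff (by positivity), ENNReal.rpow_natCast] at hlt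
  exact_mod_cast hlt.le

/-- The seminorm is `∑_{k < p} ρ⁻ᵏ ‖Nᵏ v‖`, where `p` is such that `‖Nᵖ‖ ≤ ρᵖ`. -/
theorem exists_seminorm_le_mul_of_spectralRadius_lt {ρ : ℝ≥0} (hN : spectralRadius ℂ N < ρ) :
    ∃ (s : Seminorm ℂ E) (C : ℝ), 0 < C ∧ (∀ v, ‖v‖ ≤ s v) ∧ (∀ v, s v ≤ C * ‖v‖) ∧
      ∀ v, s (N v) ≤ ρ * s v := by
  obtain ⟨p, hp, hNp⟩ := exists_norm_pow_le_of_spectralRadius_lt hN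
  have hρ : (0 : ℝ) < ρ := by exact_mod_cast pos_of_gt hN
  let s : Seminorm ℂ E :=
    ∑ k ∈ Finset.range p, ρ⁻¹ ^ k • (normSeminorm ℂ E).comp (N ^ k).toLinearMap
  have hs : ∀ v, s v = ∑ k ∈ Finset.range p, (ρ : ℝ)⁻¹ ^ k * ‖(N ^ k) v‖ := fun v => by
    simp only [s, sum_apply, smul_apply, Seminorm.comp_apply, coe_normSeminorm,
      NNReal.smul_def, NNReal.coe_pow, NNReal.coe_inv, smul_eq_mul, ContinuousLinearMap.coe_coe]
  refine ⟨s, 1 + ∑ k ∈ Finset.range p, (ρ : ℝ)⁻¹ ^ k * ‖N ^ k‖, by positivity,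
    fun v => ?_, fun v => ?_, fun v => ?_⟩
  · rw [hs]
    simpa using Finset.single_le_sum (f := fun k => (ρ : ℝ)⁻¹ ^ k * ‖(N ^ k) v‖)
      (fun k _ => by positivity) (Finset.mem_range.2 hp)
  · rw [hs, add_mul, Finset.sum_mul]
    refine le_add_of_nonneg_of_le (by positivity) (Finset.sum_le_sum fun k _ => ?_)
    rw [mul_assoc]
    gcongr
    exact (N ^ k).le_opNorm v
  · have hshift : s (N v) = ρ * ∑ k ∈ Finset.range p, (ρ : ℝ)⁻¹ ^ (k + 1) * ‖(N ^ (k + 1)) v‖ := by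
      rw [hs, Finset.mul_sum]
      refine Finset.sum_congr rfl fun k _ => ?_
      rw [pow_succ N, mul_apply_eq_comp, pow_succ (ρ : ℝ)⁻¹]
      field_simp
    have hlast : (ρ : ℝ)⁻¹ ^ p * ‖(N ^ p) v‖ ≤ ‖v‖ := by
      rw [inv_pow, inv_mul_le_iff₀ (by positivity)]
      exact (N ^ p).le_of_opNorm_le hNp v
    have hsum := Finset.sum_range_succ (fun k => (ρ : ℝ)⁻¹ ^ k * ‖(N ^ k) v‖) p
    rw [Finset.sum_range_succ', pow_zero, pow_zero, one_mul, one_apply_eq_self] at hsum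
    rw [hshift, hs]
    exact mul_le_mul_of_nonneg_left (by linarith) hρ.le

end SpectralGap

section GapSeminorm

variable {Ω : Type*} [MeasurableSpace Ω] {T : Ω → Ω} {μ : Measure Ω} [IsProbabilityMeasure μ]
  {F : Type*} [NormedCommRing F] [NormedAlgebra ℂ F] {ι : F →ₗ[ℂ] (Ω →ₘ[μ] ℂ)} {U : F →L[ℂ] F}

/-- A seminorm equivalent to the norm, in which the operator `U` contracts the distance to the mean
by the factor `ρ`. -/
structure IsGapSeminorm (hι : IsFunctionAlgebra μ ι) (U : F →L[ℂ] F) (s : Seminorm ℂ F)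
    (C ρ : ℝ) : Prop where
  norm_le : ∀ v, ‖v‖ ≤ s v
  le_norm : ∀ v, s v ≤ C * ‖v‖
  apply_sub_le : ∀ v, s (U v - hι.integralCLM v • 1) ≤ ρ * s v

theorem IsTransferOn.exists_isGapSeminorm [CompleteSpace F] (hU : IsTransferOn T ι U)
    (hι : IsFunctionAlgebra μ ι) (hT : MeasurePreserving T μ μ) (hgap : HasSpectralGap U) :
    ∃ (s : Seminorm ℂ F) (C ρ : ℝ), 0 < C ∧ 0 ≤ ρ ∧ ρ < 1 ∧ IsGapSeminorm hι U s C ρ := by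
  obtain ⟨N, hN, hUN⟩ := hgap.exists_eq_smul_add
    (fun z v hv hz => hU.norm_eigenvalue_le_one hι hT hv hz) (hU.map_one hι hT)
    hι.integralCLM_one (hU.integralCLM_apply hι)
  obtain ⟨ρ, hNρ, hρ⟩ := ENNReal.lt_iff_exists_nnreal_btwn.1 hN
  obtain ⟨s, C, hC, hle, hge, hsN⟩ := exists_seminorm_le_mul_of_spectralRadius_lt hNρ
  refine ⟨s, C, ρ, hC, ρ.2, by exact_mod_cast hρ, hle, hge, fun v => ?_⟩
  rw [hUN, add_sub_cancel_left]
  exact hsN v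

end GapSeminorm

section TiltedIterates

variable {Ω : Type*} [MeasurableSpace Ω] {T : Ω → Ω} {μ : Measure Ω}
  {F : Type*} [NormedCommRing F] [NormedAlgebra ℂ F] {ι : F →ₗ[ℂ] (Ω →ₘ[μ] ℂ)} {U : F →L[ℂ] F}

theorem IsTransferOn.integral_iterate_mul (hU : IsTransferOn T ι U) (hι : IsFunctionAlgebra μ ι)
    (hT : MeasurePreserving T μ μ) (k : F) (n : ℕ) {w : Ω → ℂ} (hw : MemLp w ∞ μ) :
    ∫ x, ι ((fun h => U (k * h))^[n] 1) x * w x ∂μ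
      = ∫ x, (∏ i ∈ Finset.range n, ι k (T^[i] x)) * w (T^[n] x) ∂μ := by
  induction n generalizing w with
  | zero =>
    refine integral_congr_ae ?_
    filter_upwards [hι.coe_one] with x hx
    simp [hx]
  | succ n ih =>
    set h := (fun h => U (k * h))^[n] 1
    have hw' : MemLp (fun x => ι k x * w (T x)) ∞ μ :=
      (hw.comp_measurePreserving hT).mul (p := ∞) (q := ∞) (r := ∞) (hι.memLp_top k)
    calc ∫ x, ι ((fun h => U (k * h))^[n + 1] 1) x * w x ∂μ
        = ∫ x, ι (k * h) x * w (T x) ∂μ := by rw [Function.iterate_succ_apply', hU _ _ hw]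
      _ = ∫ x, ι h x * (ι k x * w (T x)) ∂μ := by
        refine integral_congr_ae ?_
        rw [hι.map_mul]
        filter_upwards [AEEqFun.coeFn_mul (ι k) (ι h)] with x hx
        rw [hx, Pi.mul_apply]
        ring
      _ = ∫ x, (∏ i ∈ Finset.range (n + 1), ι k (T^[i] x)) * w (T^[n + 1] x) ∂μ := by
        rw [ih hw']
        simp only [Finset.prod_range_succ, Function.iterate_succ_apply', mul_assoc]

variable {g : F} {G : Ω → ℝ}

theorem Represents.integralCLM_iterate [IsFiniteMeasure μ] (hg : Represents ι g G)
    (hU : IsTransferOn T ι U) (hι : IsFunctionAlgebra μ ι) (hT : MeasurePreserving T μ μ) (n : ℕ) :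
    hι.integralCLM ((fun h => U (g * h))^[n] 1)
      = ((∫ x, ∏ i ∈ Finset.range n, G (T^[i] x) ∂μ : ℝ) : ℂ) := by
  have h := hU.integral_iterate_mul hι hT g n (memLp_const 1)
  simp only [mul_one] at h
  rw [hι.integralCLM_apply, h, ← integral_complex_ofReal]
  refine integral_congr_ae ?_
  filter_upwards [ae_all_iff.2 fun i => (hT.iterate i).quasiMeasurePreserving.ae hg] with x hx
  push_cast
  exact Finset.prod_congr rfl fun i _ => hx i

theorem Represents.norm_integralCLM_mul_le [IsFiniteMeasure μ] (hg : Represents ι g G)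
    (hι : IsFunctionAlgebra μ ι) (hG : ∀ x, 0 ≤ G x) (r : F) :
    ‖hι.integralCLM (g * r)‖ ≤ (∫ x, G x ∂μ) * ‖r‖ := by
  have hnorm : ∀ᵐ x ∂μ, ‖ι g x‖ = G x := by
    filter_upwards [hg] with x hx
    rw [hx, Complex.norm_real, Real.norm_of_nonneg (hG x)]
  rw [hι.integralCLM_apply, ← integral_mul_const]
  refine norm_integral_le_of_norm_le (((hι.integrable g).norm.congr hnorm).mul_const _) ?_
  rw [hι.map_mul]
  filter_upwards [hnorm, AEEqFun.coeFn_mul (ι g) (ι r), hι.ae_norm_le r] with x hx hm hr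
  rw [hm, Pi.mul_apply, norm_mul, hx]
  exact mul_le_mul_of_nonneg_left hr (hG x)

/-- The deviation of an element of the function algebra from its mean. -/
noncomputable def IsFunctionAlgebra.center [IsFiniteMeasure μ] (hι : IsFunctionAlgebra μ ι)
    (h : F) : F :=
  h - hι.integralCLM h • 1

theorem IsFunctionAlgebra.integral_smul_one_add_center [IsFiniteMeasure μ]
    (hι : IsFunctionAlgebra μ ι) (h : F) : hι.integralCLM h • 1 + hι.center h = h :=
  add_sub_cancel _ _

theorem IsFunctionAlgebra.integralCLM_one_add_smul_mul [IsFiniteMeasure μ]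
    (hι : IsFunctionAlgebra μ ι) (t : ℂ) (g h : F) :
    hι.integralCLM ((1 + t • g) * h)
      = hι.integralCLM h * (1 + t * hι.integralCLM g) + t * hι.integralCLM (g * hι.center h) := by
  have hgh : g * h = hι.integralCLM h • g + g * hι.center h := by
    conv_lhs => rw [← hι.integral_smul_one_add_center h, mul_add, mul_smul_comm, mul_one]
  rw [add_mul, one_mul, smul_mul_assoc, hgh]
  simp only [map_add, map_smul, smul_eq_mul]
  ring

variable [IsProbabilityMeasure μ]

theorem IsTransferOn.center_apply_one_add_smul_mul (hU : IsTransferOn T ι U)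
    (hι : IsFunctionAlgebra μ ι) (hT : MeasurePreserving T μ μ) (t : ℂ) (g h : F) :
    hι.center (U ((1 + t • g) * h))
      = (U (hι.center h) - hι.integralCLM (hι.center h) • 1)
        + t • (U (g * h) - hι.integralCLM (g * h) • 1) := by
  simp only [IsFunctionAlgebra.center, hU.integralCLM_apply hι, hU.map_one hι hT,
    hι.integralCLM_one, add_mul, one_mul, smul_mul_assoc, map_add, map_sub, map_smul, smul_eq_mul,
    mul_one, add_smul, smul_sub, smul_smul, sub_self, zero_smul, sub_zero]
  abel

theorem IsFunctionAlgebra.norm_le_norm_integralCLM_add {hι : IsFunctionAlgebra μ ι}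
    {s : Seminorm ℂ F} (hs : ∀ v, ‖v‖ ≤ s v) (h : F) :
    ‖h‖ ≤ (‖(1 : F)‖ + 1) * (‖hι.integralCLM h‖ + s (hι.center h)) := by
  have hdec : ‖h‖ ≤ ‖hι.integralCLM h‖ * ‖(1 : F)‖ + s (hι.center h) := by
    conv_lhs => rw [← hι.integral_smul_one_add_center h]
    exact (norm_add_le _ _).trans (add_le_add (norm_smul_le _ _) (hs _))
  nlinarith [norm_nonneg (hι.integralCLM h), norm_nonneg (1 : F), apply_nonneg s (hι.center h),
    mul_nonneg (norm_nonneg (1 : F)) (apply_nonneg s (hι.center h))]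

variable {hι : IsFunctionAlgebra μ ι} {s : Seminorm ℂ F} {C ρ K : ℝ}

theorem IsGapSeminorm.abs_norm_integralCLM_sub_le (hs : IsGapSeminorm hι U s C ρ)
    (hU : IsTransferOn T ι U) (hg : Represents ι g G) (hG : ∀ x, 0 ≤ G x) {t : ℝ}
    (ht : 0 ≤ 1 + t * ∫ x, G x ∂μ) (h : F) :
    |‖hι.integralCLM (U ((1 + (t : ℂ) • g) * h))‖ - ‖hι.integralCLM h‖ * (1 + t * ∫ x, G x ∂μ)|
      ≤ |t| * (∫ x, G x ∂μ) * s (hι.center h) := by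
  have hmain : ‖hι.integralCLM h‖ * (1 + t * ∫ x, G x ∂μ)
      = ‖hι.integralCLM h * (1 + t * hι.integralCLM g)‖ := by
    rw [hg.integralCLM_eq hι, norm_mul, ← Complex.ofReal_mul, ← Complex.ofReal_one,
      ← Complex.ofReal_add, Complex.norm_real, Real.norm_of_nonneg ht]
  rw [hmain, hU.integralCLM_apply hι, hι.integralCLM_one_add_smul_mul]
  refine (abs_norm_sub_norm_le _ _).trans ?_
  rw [add_sub_cancel_left, norm_mul, Complex.norm_real, Real.norm_eq_abs, mul_assoc]
  gcongr
  exact (hg.norm_integralCLM_mul_le hι hG _).trans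
    (mul_le_mul_of_nonneg_left (hs.norm_le _) (integral_nonneg hG))

theorem IsGapSeminorm.apply_center_le (hs : IsGapSeminorm hι U s C ρ) (hC : 0 ≤ C) (hρ : ρ ≤ 1)
    (hU : IsTransferOn T ι U) (hT : MeasurePreserving T μ μ) (hgK : ‖g‖ ≤ K) (t : ℝ) (h : F) :
    s (hι.center (U ((1 + (t : ℂ) • g) * h)))
      ≤ ρ * s (hι.center h) + |t| * (C * K * (‖(1 : F)‖ + 1)
        * (‖hι.integralCLM h‖ + s (hι.center h))) := by
  have hgh : s (U (g * h) - hι.integralCLM (g * h) • 1)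
      ≤ C * K * (‖(1 : F)‖ + 1) * (‖hι.integralCLM h‖ + s (hι.center h)) :=
    calc s (U (g * h) - hι.integralCLM (g * h) • 1) ≤ ρ * s (g * h) := hs.apply_sub_le _
      _ ≤ s (g * h) := mul_le_of_le_one_left (apply_nonneg _ _) hρ
      _ ≤ C * (‖g‖ * ‖h‖) := (hs.le_norm _).trans (by gcongr; exact norm_mul_le _ _)
      _ ≤ C * (K * ((‖(1 : F)‖ + 1) * (‖hι.integralCLM h‖ + s (hι.center h)))) := by
        have := (norm_nonneg g).trans hgK
        gcongr
        exact IsFunctionAlgebra.norm_le_norm_integralCLM_add hs.norm_le h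
      _ = _ := by ring
  rw [hU.center_apply_one_add_smul_mul hι hT]
  refine (map_add_le_add s _ _).trans (add_le_add (hs.apply_sub_le _) ?_)
  rw [map_smul_eq_mul, Complex.norm_real, Real.norm_eq_abs]
  gcongr

/-- One step of the recursion for the mean `a` and the deviation `σ` of the tilted iterates: the
cone `σ ≤ B |t| a` is invariant, and within it the mean grows at most by the stated factor. -/
theorem tilted_step_le {ρ A B t m a σ a' σ' : ℝ} (hρ₀ : 0 ≤ ρ) (hA : 0 ≤ A) (hB : 0 ≤ B)
    (hAB : B * (1 - ρ) = 4 * A) (ht : |t| ≤ (1 - ρ) / 4) (hBt : B * |t| ≤ 1) (hm : m ∈ Set.Icc 0 1)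
    (ha : 0 ≤ a) (hσ : σ ≤ B * |t| * a) (ha' : |a' - a * (1 + t * m)| ≤ |t| * m * σ)
    (hσ' : σ' ≤ ρ * σ + |t| * (A * (a + σ))) :
    σ' ≤ B * |t| * a' ∧ a' ≤ a * (1 + (t * m + B * t ^ 2 * m)) := by
  obtain ⟨hm0, hm1⟩ := hm
  have ht0 := abs_nonneg t
  have hσa : σ ≤ a := hσ.trans (mul_le_of_le_one_left ha hBt)
  have herr : |t| * m * σ ≤ |t| * m * (B * |t| * a) := by gcongr
  obtain ⟨hlow, hup⟩ := abs_le.1 ha'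
  constructor
  · have htm : -|t| ≤ t * m :=
      calc -|t| ≤ -|t * m| := by
            rw [abs_mul, abs_of_nonneg hm0]
            exact neg_le_neg (mul_le_of_le_one_right ht0 hm1)
        _ ≤ t * m := neg_abs_le _
    have herr' : |t| * m * σ ≤ |t| * 1 * a :=
      calc |t| * m * σ ≤ |t| * m * a := by gcongr
        _ ≤ |t| * 1 * a := by gcongr
    have hlow' : a * (1 - 2 * |t|) ≤ a' := by
      have := mul_le_mul_of_nonneg_left htm ha
      linarith
    calc σ' ≤ ρ * (B * |t| * a) + |t| * (A * (a + a)) := hσ'.trans (by gcongr)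
      _ = |t| * a * (ρ * B + 2 * A) := by ring
      _ ≤ |t| * a * (B * (1 - 2 * |t|)) := by
        gcongr
        nlinarith
      _ = B * |t| * (a * (1 - 2 * |t|)) := by ring
      _ ≤ B * |t| * a' := by gcongr
  · calc a' ≤ a * (1 + t * m) + |t| * m * (B * |t| * a) := by linarith
      _ = a * (1 + (t * m + B * |t| ^ 2 * m)) := by ring
      _ = _ := by rw [sq_abs]

theorem integral_mem_Icc_zero_one (hG : ∀ x, G x ∈ Set.Icc 0 1) :
    ∫ x, G x ∂μ ∈ Set.Icc 0 1 := by
  refine ⟨integral_nonneg fun x => (hG x).1, ?_⟩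
  simpa using integral_mono_of_nonneg (μ := μ) (.of_forall fun x => (hG x).1)
    (integrable_const (1 : ℝ)) (.of_forall fun x => (hG x).2)

theorem IsGapSeminorm.apply_one_add_smul_mul_le (hs : IsGapSeminorm hι U s C ρ) (hC : 0 ≤ C)
    (hρ₀ : 0 ≤ ρ) (hρ : ρ ≤ 1) (hU : IsTransferOn T ι U) (hT : MeasurePreserving T μ μ)
    (hg : Represents ι g G) (hG : ∀ x, G x ∈ Set.Icc 0 1) (hgK : ‖g‖ ≤ K) {B t : ℝ} (hB : 0 ≤ B)
    (hKB : B * (1 - ρ) = 4 * (C * K * (‖(1 : F)‖ + 1))) (ht : |t| ≤ (1 - ρ) / 4)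
    (hBt : B * |t| ≤ 1) {h : F} (hh : s (hι.center h) ≤ B * |t| * ‖hι.integralCLM h‖) :
    s (hι.center (U ((1 + (t : ℂ) • g) * h)))
        ≤ B * |t| * ‖hι.integralCLM (U ((1 + (t : ℂ) • g) * h))‖ ∧
      ‖hι.integralCLM (U ((1 + (t : ℂ) • g) * h))‖
        ≤ ‖hι.integralCLM h‖ * (1 + (t * (∫ x, G x ∂μ) + B * t ^ 2 * ∫ x, G x ∂μ)) := by
  have hm := integral_mem_Icc_zero_one (μ := μ) hG
  have htm : 0 ≤ 1 + t * ∫ x, G x ∂μ := by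
    have := abs_le.1 ht
    nlinarith [hm.1, hm.2]
  have hK : 0 ≤ K := (norm_nonneg g).trans hgK
  exact tilted_step_le hρ₀ (by positivity) hB hKB ht hBt hm (norm_nonneg _) hh
    (hs.abs_norm_integralCLM_sub_le hU hg (fun x => (hG x).1) htm h)
    (hs.apply_center_le hC hρ hU hT hgK t h)

theorem IsGapSeminorm.integral_prod_one_add_le (hs : IsGapSeminorm hι U s C ρ) (hC : 0 ≤ C)
    (hρ₀ : 0 ≤ ρ) (hρ : ρ ≤ 1) (hU : IsTransferOn T ι U) (hT : MeasurePreserving T μ μ)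
    (hg : Represents ι g G) (hG : ∀ x, G x ∈ Set.Icc 0 1) (hgK : ‖g‖ ≤ K) {B t : ℝ} (hB : 0 ≤ B)
    (hKB : B * (1 - ρ) = 4 * (C * K * (‖(1 : F)‖ + 1))) (ht : |t| ≤ (1 - ρ) / 4)
    (hBt : B * |t| ≤ 1) (n : ℕ) :
    ∫ x, ∏ i ∈ Finset.range n, (1 + t * G (T^[i] x)) ∂μ
      ≤ Real.exp (n * (t * (∫ x, G x ∂μ) + B * t ^ 2 * ∫ x, G x ∂μ)) := by
  set c := t * (∫ x, G x ∂μ) + B * t ^ 2 * ∫ x, G x ∂μ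
  set h : ℕ → F := fun n => (fun h => U ((1 + (t : ℂ) • g) * h))^[n] 1 with hh
  have hcone : ∀ n, s (hι.center (h n)) ≤ B * |t| * ‖hι.integralCLM (h n)‖ ∧
      ‖hι.integralCLM (h n)‖ ≤ Real.exp (n * c) := by
    intro n
    induction n with
    | zero =>
      have hone : hι.integralCLM (h 0) = 1 := hι.integralCLM_one
      have hcenter : hι.center (h 0) = 0 := by
        simp [hh, IsFunctionAlgebra.center, hι.integralCLM_one]
      refine ⟨?_, by simp [hone]⟩
      rw [hcenter, map_zero]
      positivity
    | succ n ih =>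
      have hsucc : h (n + 1) = U ((1 + (t : ℂ) • g) * h n) := Function.iterate_succ_apply' _ _ _
      obtain ⟨hstep, hle⟩ := hs.apply_one_add_smul_mul_le hC hρ₀ hρ hU hT hg hG hgK hB hKB ht hBt
        ih.1
      rw [← hsucc] at hstep hle
      refine ⟨hstep, ?_⟩
      calc ‖hι.integralCLM (h (n + 1))‖ ≤ ‖hι.integralCLM (h n)‖ * (1 + c) := hle
        _ ≤ ‖hι.integralCLM (h n)‖ * Real.exp c := by
          gcongr
          linarith [Real.add_one_le_exp c]
        _ ≤ Real.exp (n * c) * Real.exp c := by gcongr; exact ih.2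
        _ = Real.exp ((n + 1 : ℕ) * c) := by rw [Nat.cast_succ, add_one_mul, Real.exp_add (n * c)]
  have hrep := ((hg.const_smul t).one_add hι).integralCLM_iterate hU hι hT n
  calc _ ≤ ‖hι.integralCLM (h n)‖ := by
        rw [hrep, Complex.norm_real]
        exact le_abs_self _
    _ ≤ _ := (hcone n).2

theorem IsTransferOn.exists_integral_prod_one_add_le [CompleteSpace F] (hU : IsTransferOn T ι U)
    (hι : IsFunctionAlgebra μ ι) (hT : MeasurePreserving T μ μ) (hgap : HasSpectralGap U)
    (hK : 0 ≤ K) :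
    ∃ t₀ B : ℝ, 0 < t₀ ∧ t₀ ≤ 1 / 4 ∧ 0 ≤ B ∧
      ∀ (G : Ω → ℝ) (g : F), (∀ x, G x ∈ Set.Icc 0 1) → Represents ι g G → ‖g‖ ≤ K →
        ∀ t : ℝ, |t| ≤ t₀ → ∀ n : ℕ,
          ∫ x, ∏ i ∈ Finset.range n, (1 + t * G (T^[i] x)) ∂μ
            ≤ Real.exp (n * (t * (∫ x, G x ∂μ) + B * t ^ 2 * ∫ x, G x ∂μ)) := by
  obtain ⟨s, C, ρ, hC, hρ₀, hρ, hs⟩ := hU.exists_isGapSeminorm hι hT hgap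
  have hρ' : 0 < 1 - ρ := by linarith
  set B := 4 * (C * K * (‖(1 : F)‖ + 1)) / (1 - ρ)
  have hB0 : 0 ≤ B := by positivity
  refine ⟨min ((1 - ρ) / 4) (1 / (B + 1)), B, by positivity,
    (min_le_left _ _).trans (by linarith), hB0, fun G g hG hg hgK t ht n => ?_⟩
  have hBt : (B + 1) * |t| ≤ 1 := by
    rw [mul_comm]
    exact (le_div_iff₀ (by positivity)).1 (ht.trans (min_le_right _ _))
  exact hs.integral_prod_one_add_le hC.le hρ₀ hρ.le hU hT hg hG hgK hB0 (div_mul_cancel₀ _ hρ'.ne')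
    (ht.trans (min_le_left _ _)) (by linarith [abs_nonneg t]) n

end TiltedIterates

section Bernstein

variable {Ω : Type*} {T : Ω → Ω} {G : Ω → ℝ}

theorem exp_log_mul_birkhoffSum_le_prod (hG : ∀ x, G x ∈ Set.Icc 0 1) {t : ℝ} (ht : -1 < t)
    (n : ℕ) (x : Ω) :
    Real.exp (Real.log (1 + t) * birkhoffSum T G n x)
      ≤ ∏ i ∈ Finset.range n, (1 + t * G (T^[i] x)) := by
  rw [birkhoffSum, Finset.mul_sum, Real.exp_sum]
  refine Finset.prod_le_prod (fun i _ => (Real.exp_pos _).le) fun i _ => ?_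
  rw [← Real.rpow_def_of_pos (by linarith), mul_comm t]
  exact rpow_one_add_le_one_add_mul_self ht.le (hG _).1 (hG _).2

theorem birkhoffSum_mem_Icc (hG : ∀ x, G x ∈ Set.Icc 0 1) (n : ℕ) (x : Ω) :
    birkhoffSum T G n x ∈ Set.Icc (0 : ℝ) n := by
  refine ⟨Finset.sum_nonneg fun i _ => (hG _).1, ?_⟩
  simpa [birkhoffSum] using Finset.sum_le_card_nsmul (Finset.range n) (fun i => G (T^[i] x)) 1
    fun i _ => (hG _).2

variable [MeasurableSpace Ω] {μ : Measure Ω}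

theorem aestronglyMeasurable_birkhoffSum (hT : MeasurePreserving T μ μ)
    (hGm : AEStronglyMeasurable G μ) (n : ℕ) : AEStronglyMeasurable (birkhoffSum T G n) μ :=
  Finset.aestronglyMeasurable_fun_sum _ fun i _ => hGm.comp_measurePreserving (hT.iterate i)

theorem integrable_prod_one_add_mul [IsFiniteMeasure μ] (hT : MeasurePreserving T μ μ)
    (hGm : AEStronglyMeasurable G μ) (hG : ∀ x, G x ∈ Set.Icc 0 1) (t : ℝ) (n : ℕ) :
    Integrable (fun x => ∏ i ∈ Finset.range n, (1 + t * G (T^[i] x))) μ := by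
  refine Integrable.of_bound (C := (1 + |t|) ^ n)
    (Finset.aestronglyMeasurable_fun_prod _ fun i _ => aestronglyMeasurable_const.add
      ((hGm.comp_measurePreserving (hT.iterate i)).const_mul t)) (.of_forall fun x => ?_)
  rw [norm_prod]
  refine (Finset.prod_le_prod (fun i _ => norm_nonneg _) fun i _ => ?_).trans_eq
    (by rw [Finset.prod_const, Finset.card_range])
  obtain ⟨hG0, hG1⟩ := hG (T^[i] x)
  calc |1 + t * G (T^[i] x)| ≤ |1| + |t * G (T^[i] x)| := abs_add_le _ _
    _ = 1 + |t| * G (T^[i] x) := by rw [abs_one, abs_mul, abs_of_nonneg hG0]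
    _ ≤ 1 + |t| := by gcongr; exact mul_le_of_le_one_right (abs_nonneg t) hG1

theorem mgf_birkhoffSum_le_integral_prod [IsFiniteMeasure μ] (hT : MeasurePreserving T μ μ)
    (hGm : AEStronglyMeasurable G μ) (hG : ∀ x, G x ∈ Set.Icc 0 1) {t : ℝ} (ht : -1 < t) (n : ℕ) :
    mgf (birkhoffSum T G n) μ (Real.log (1 + t))
      ≤ ∫ x, ∏ i ∈ Finset.range n, (1 + t * G (T^[i] x)) ∂μ :=
  integral_mono_of_nonneg (.of_forall fun _ => (Real.exp_pos _).le)
    (integrable_prod_one_add_mul hT hGm hG t n)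
    (.of_forall (exp_log_mul_birkhoffSum_le_prod hG ht n))

theorem abs_log_one_add_sub_le {r : ℝ} (hr : |r| ≤ 1 / 2) :
    |Real.log (1 + r) - r| ≤ 2 * r ^ 2 := by
  have h := Real.abs_log_sub_add_sum_range_le (x := -r) (by rw [abs_neg]; linarith) 1
  rw [abs_neg] at h
  calc |Real.log (1 + r) - r| ≤ |r| ^ 2 / (1 - |r|) := by simpa [neg_add_eq_sub] using h
    _ ≤ 2 * r ^ 2 := by
        rw [sq_abs, div_le_iff₀ (by linarith)]
        nlinarith [sq_nonneg r]

theorem measureReal_le_abs_sub_le_of_mgf_le [IsFiniteMeasure μ] {X : Ω → ℝ} {M B t u : ℝ}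
    (hX : ∀ s, Integrable (fun x => Real.exp (s * X x)) μ) (hM : 0 ≤ M)
    (ht : 0 ≤ t) (ht' : t ≤ 1 / 4) (hu : 0 ≤ u)
    (hmgf : ∀ r, |r| ≤ t → mgf X μ (Real.log (1 + r)) ≤ Real.exp (r * M + B * r ^ 2 * M)) :
    μ.real {x | u ≤ |X x - M|} ≤ 2 * Real.exp (-(t * u / 2) + (B + 2) * t ^ 2 * M) := by
  have hlog := abs_le.1 (abs_log_one_add_sub_le (r := t) (by rw [abs_of_nonneg ht]; linarith))
  have hlog' := abs_le.1
    (abs_log_one_add_sub_le (r := -t) (by rw [abs_neg, abs_of_nonneg ht]; linarith))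
  have htu : 0 ≤ (1 / 4 - t) * (t * u) := mul_nonneg (by linarith) (mul_nonneg ht hu)
  have hupper : μ.real {x | M + u ≤ X x} ≤ Real.exp (-(t * u / 2) + (B + 2) * t ^ 2 * M) := by
    have hs : 0 ≤ Real.log (1 + t) := Real.log_nonneg (by linarith)
    refine (measure_ge_le_exp_mul_mgf _ hs (hX _)).trans ?_
    refine (mul_le_mul_of_nonneg_left (hmgf t (abs_of_nonneg ht).le) (Real.exp_nonneg _)).trans ?_
    rw [← Real.exp_add, Real.exp_le_exp]
    nlinarith
  have hlower : μ.real {x | X x ≤ M - u} ≤ Real.exp (-(t * u / 2) + (B + 2) * t ^ 2 * M) := by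
    have hs : Real.log (1 + -t) ≤ 0 := Real.log_nonpos (by linarith) (by linarith)
    refine (measure_le_le_exp_mul_mgf _ hs (hX _)).trans ?_
    refine (mul_le_mul_of_nonneg_left (hmgf (-t) (by rw [abs_neg, abs_of_nonneg ht]))
      (Real.exp_nonneg _)).trans ?_
    rw [← Real.exp_add, Real.exp_le_exp]
    nlinarith
  calc μ.real {x | u ≤ |X x - M|} ≤ μ.real ({x | M + u ≤ X x} ∪ {x | X x ≤ M - u}) :=
        measureReal_mono fun x hx => (le_abs.1 hx).imp (fun h => by rwa [Set.mem_ofPred_eq,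
          ← le_sub_iff_add_le']) (fun h => by rwa [Set.mem_ofPred_eq, le_sub_comm, ← neg_sub])
    _ ≤ _ := measureReal_union_le _ _
    _ ≤ _ := by linarith

/-- A Bernstein inequality for the Birkhoff sums of `G`. The free parameter `t` plays the role of
the exponent in the Chernoff bound; it is bounded by `t₀`. -/
def BernsteinBound (T : Ω → Ω) (μ : Measure Ω) (G : Ω → ℝ) (t₀ C : ℝ) : Prop :=
  ∀ t ∈ Set.Icc 0 t₀, ∀ (n : ℕ) (u : ℝ), 0 ≤ u →
    μ.real {x | u ≤ |birkhoffSum T G n x - n * ∫ y, G y ∂μ|}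
      ≤ 2 * Real.exp (-(t * u / 2) + C * t ^ 2 * (n * ∫ y, G y ∂μ))

theorem bernsteinBound_of_integral_prod_le [IsFiniteMeasure μ] (hT : MeasurePreserving T μ μ)
    (hGm : AEStronglyMeasurable G μ) (hG : ∀ x, G x ∈ Set.Icc 0 1) {t₀ B : ℝ} (ht₀ : t₀ ≤ 1 / 4)
    (hprod : ∀ t : ℝ, |t| ≤ t₀ → ∀ n : ℕ, ∫ x, ∏ i ∈ Finset.range n, (1 + t * G (T^[i] x)) ∂μ
      ≤ Real.exp (n * (t * (∫ x, G x ∂μ) + B * t ^ 2 * ∫ x, G x ∂μ))) :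
    BernsteinBound T μ G t₀ (B + 2) := by
  intro t ht n u hu
  have hmean : 0 ≤ n * ∫ x, G x ∂μ :=
    mul_nonneg n.cast_nonneg (integral_nonneg fun x => (hG x).1)
  refine measureReal_le_abs_sub_le_of_mgf_le (fun s => integrable_exp_mul_of_mem_Icc
    (aestronglyMeasurable_birkhoffSum hT hGm n).aemeasurable
    (.of_forall (birkhoffSum_mem_Icc hG n))) hmean ht.1 (ht.2.trans ht₀) hu fun r hr => ?_
  have hr' : -1 < r := by linarith [(abs_le.1 hr).1, ht.2]
  refine ((mgf_birkhoffSum_le_integral_prod hT hGm hG hr' n).trans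
    (hprod r (hr.trans ht.2) n)).trans_eq ?_
  congr 1
  ring

theorem IsTransferOn.exists_bernsteinBound [IsProbabilityMeasure μ] {F : Type*} [NormedCommRing F]
    [NormedAlgebra ℂ F] [CompleteSpace F] {ι : F →ₗ[ℂ] (Ω →ₘ[μ] ℂ)} {U : F →L[ℂ] F}
    (hU : IsTransferOn T ι U) (hι : IsFunctionAlgebra μ ι) (hT : MeasurePreserving T μ μ)
    (hgap : HasSpectralGap U) {K : ℝ} (hK : 0 ≤ K) :
    ∃ t₀ C : ℝ, 0 < t₀ ∧ 0 < C ∧ ∀ (G : Ω → ℝ) (g : F), (∀ x, G x ∈ Set.Icc 0 1) →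
      Represents ι g G → ‖g‖ ≤ K → BernsteinBound T μ G t₀ C := by
  obtain ⟨t₀, B, ht₀, ht₀', hB, hprod⟩ := hU.exists_integral_prod_one_add_le hι hT hgap hK
  exact ⟨t₀, B + 2, ht₀, by positivity, fun G g hG hg hgK =>
    bernsteinBound_of_integral_prod_le hT hg.aestronglyMeasurable hG ht₀' (hprod G g hG hg hgK)⟩

end Bernstein

section StrongLaw

variable {Ω : Type*} [MeasurableSpace Ω] {T : Ω → Ω} {μ : Measure Ω}

theorem BernsteinBound.measureReal_le_inv_sq {G : Ω → ℝ} {t₀ C δ t : ℝ}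
    (hB : BernsteinBound T μ G t₀ C) (hδ : 0 ≤ δ) (ht : t ∈ Set.Icc 0 t₀) (htC : C * t ≤ δ / 4)
    {n : ℕ} (hn : n ≠ 0) (hm : 0 ≤ n * ∫ x, G x ∂μ)
    (hlog : 8 * Real.log n ≤ t * δ * (n * ∫ x, G x ∂μ)) :
    μ.real {x | δ * (n * ∫ x, G x ∂μ) ≤ |birkhoffSum T G n x - n * ∫ x, G x ∂μ|}
      ≤ 2 * ((n : ℝ) ^ 2)⁻¹ := by
  refine (hB t ht n _ (mul_nonneg hδ hm)).trans ?_
  have hsq : ((n : ℝ) ^ 2)⁻¹ = Real.exp (-(2 * Real.log n)) := by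
    rw [Real.exp_neg, two_mul, Real.exp_add, Real.exp_log (by positivity), pow_two]
  rw [hsq]
  gcongr
  have := mul_le_mul_of_nonneg_right htC (mul_nonneg ht.1 hm)
  linarith

variable [IsFiniteMeasure μ]

theorem ae_eventually_notMem_of_summable {κ : Type*} [Countable κ] {s : κ → Set Ω} {w : κ → ℝ}
    (hw : Summable w) (hs : ∀ᶠ i in cofinite, μ.real (s i) ≤ w i) :
    ∀ᵐ x ∂μ, ∀ᶠ i in cofinite, x ∉ s i := by
  have hsum : Summable fun i => μ.real (s i) := by
    refine Summable.of_norm_bounded_eventually hw ?_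
    filter_upwards [hs] with i hi
    rwa [Real.norm_of_nonneg measureReal_nonneg]
  have hfin : ∑' i, μ (s i) ≠ ∞ := by simpa using hsum.tsum_ofReal_ne_top
  filter_upwards [ae_finite_setOfPred_mem hfin] with x hx
  exact hx.compl_mem_cofinite

theorem ae_tendsto_birkhoffSum_div {G : ℕ → Ω → ℝ} {t₀ C : ℝ} (ht₀ : 0 < t₀) (hC : 0 < C)
    (hB : ∀ n, BernsteinBound T μ (G n) t₀ C) (hpos : ∀ᶠ n : ℕ in atTop, 0 < n * ∫ x, G n x ∂μ)
    (hlog : Tendsto (fun n : ℕ => Real.log n / (n * ∫ x, G n x ∂μ)) atTop (𝓝 0)) :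
    ∀ᵐ x ∂μ, Tendsto (fun n : ℕ => birkhoffSum T (G n) n x / (n * ∫ x, G n x ∂μ)) atTop (𝓝 1) := by
  set M : ℕ → ℝ := fun n => n * ∫ x, G n x ∂μ
  have hclose : ∀ q : ℕ, ∀ᵐ x ∂μ, ∀ᶠ n in atTop,
      |birkhoffSum T (G n) n x - M n| < 1 / (q + 1) * M n := by
    intro q
    set δ : ℝ := 1 / (q + 1)
    have hδ : 0 < δ := by positivity
    set t : ℝ := min t₀ (δ / (4 * C))
    have ht : 0 < t := lt_min ht₀ (by positivity)
    have htC : C * t ≤ δ / 4 := by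
      have := (le_div_iff₀ (by positivity)).1 (min_le_right t₀ (δ / (4 * C)))
      linarith
    have hbad : ∀ᶠ n : ℕ in cofinite,
        μ.real {x | δ * M n ≤ |birkhoffSum T (G n) n x - M n|} ≤ 2 * ((n : ℝ) ^ 2)⁻¹ := by
      rw [Nat.cofinite_eq_atTop]
      filter_upwards [hpos, hlog.eventually_lt_const (u := t * δ / 8) (by positivity)]
        with n hn hlogn
      refine (hB n).measureReal_le_inv_sq hδ.le ⟨ht.le, min_le_left _ _⟩ htC ?_ hn.le ?_
      · rintro rfl
        simp at hn
      · linarith [(div_lt_iff₀ hn).1 hlogn]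
    have hw : Summable fun n : ℕ => 2 * ((n : ℝ) ^ 2)⁻¹ :=
      (Real.summable_nat_pow_inv.2 one_lt_two).mul_left 2
    simpa only [Nat.cofinite_eq_atTop, Set.mem_ofPred_eq, not_le] using
      ae_eventually_notMem_of_summable hw hbad
  filter_upwards [ae_all_iff.2 hclose] with x hx
  rw [Metric.tendsto_nhds]
  intro e he
  obtain ⟨q, hq⟩ := exists_nat_one_div_lt he
  filter_upwards [hx q, hpos] with n hn hM
  rw [Real.dist_eq, div_sub_one hM.ne', abs_div, abs_of_pos hM, div_lt_iff₀ hM]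
  exact hn.trans (by gcongr)

end StrongLaw

section Truncation

variable {Ω : Type*} {χ : Ω → ℝ}

/-- The indicator function of `{χ > ℓ}`; its Birkhoff sums count the terms exceeding `ℓ`. -/
noncomputable def exceedance (χ : Ω → ℝ) (ℓ : ℝ) : Ω → ℝ :=
  {y | ℓ < χ y}.indicator 1

theorem exceedance_of_lt {ℓ : ℝ} {y : Ω} (hy : ℓ < χ y) : exceedance χ ℓ y = 1 :=
  Set.indicator_of_mem (s := {y | ℓ < χ y}) hy 1

theorem exceedance_of_le {ℓ : ℝ} {y : Ω} (hy : χ y ≤ ℓ) : exceedance χ ℓ y = 0 :=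
  Set.indicator_of_notMem (s := {y | ℓ < χ y}) hy.not_gt 1

theorem truncate_of_lt {ℓ : ℝ} {y : Ω} (hy : ℓ < χ y) : truncate χ ℓ y = 0 :=
  Set.indicator_of_notMem (s := {y | χ y ≤ ℓ}) hy.not_ge χ

theorem truncate_of_le {ℓ : ℝ} {y : Ω} (hy : χ y ≤ ℓ) : truncate χ ℓ y = χ y :=
  Set.indicator_of_mem (s := {y | χ y ≤ ℓ}) hy χ

theorem exceedance_mem_Icc (χ : Ω → ℝ) (ℓ : ℝ) (y : Ω) : exceedance χ ℓ y ∈ Set.Icc 0 1 := by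
  rcases lt_or_ge ℓ (χ y) with hy | hy
  · simp [exceedance_of_lt hy]
  · simp [exceedance_of_le hy]

theorem antitone_exceedance (χ : Ω → ℝ) : Antitone (exceedance χ) := fun _ _ hℓ =>
  Set.indicator_le_indicator_of_subset (fun _ hy => hℓ.trans_lt hy) fun _ => zero_le_one

theorem truncate_mem_Icc (h0 : ∀ x, 0 ≤ χ x) {ℓ : ℝ} (hℓ : 0 ≤ ℓ) (y : Ω) :
    truncate χ ℓ y ∈ Set.Icc 0 ℓ :=
  ⟨Set.indicator_nonneg (fun y _ => h0 y) y, Set.indicator_le' (fun _ hy => hy) (fun _ _ => hℓ) y⟩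

theorem truncate_le_sub_exceedance_mul (χ : Ω → ℝ) (ℓ : ℝ) (y : Ω) :
    truncate χ ℓ y ≤ ℓ - exceedance χ ℓ y * ℓ := by
  rcases lt_or_ge ℓ (χ y) with hy | hy
  · simp [exceedance_of_lt hy, truncate_of_lt hy]
  · simpa [exceedance_of_le hy, truncate_of_le hy] using hy

variable [MeasurableSpace Ω] {μ : Measure Ω}

theorem aSeq_nonneg (f : ℕ → ℝ) (n : ℕ) : 0 ≤ aSeq μ χ f n :=
  mul_nonneg n.cast_nonneg (sub_nonneg.2 (cdf_le_one _ _))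

variable [IsProbabilityMeasure μ]

theorem mul_integral_truncate (hχ : Measurable χ) (h0 : ∀ x, 0 ≤ χ x) (f : ℕ → ℝ) (n : ℕ) :
    n * ∫ x, truncate χ (f n) x ∂μ = dSeq μ χ f n := by
  have := Measure.isProbabilityMeasure_map (μ := μ) hχ.aemeasurable
  have hpre : χ ⁻¹' Set.Icc 0 (f n) = {x | χ x ≤ f n} := by
    ext y
    simp [h0 y]
  rw [dSeq, distFun, measure_cdf, setIntegral_map (g := χ) (f := fun x : ℝ => x) measurableSet_Icc
    measurable_id.aestronglyMeasurable hχ.aemeasurable, ← integral_indicator (hχ measurableSet_Icc),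
    hpre]
  rfl

theorem mul_integral_exceedance (hχ : Measurable χ) (f : ℕ → ℝ) (n : ℕ) :
    n * ∫ x, exceedance χ (f n) x ∂μ = aSeq μ χ f n := by
  have := Measure.isProbabilityMeasure_map (μ := μ) hχ.aemeasurable
  have hcompl : {y | f n < χ y} = (χ ⁻¹' Set.Iic (f n))ᶜ := by
    ext y
    simp
  rw [aSeq, distFun, cdf_eq_real, map_measureReal_apply hχ measurableSet_Iic, exceedance,
    integral_indicator_one (measurableSet_lt measurable_const hχ), hcompl,
    probReal_compl_eq_one_sub (hχ measurableSet_Iic)]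

end Truncation

section Trimming

variable {Ω : Type*} {T : Ω → Ω} {χ : Ω → ℝ} {ℓ : ℝ} {n b : ℕ} {x : Ω}

theorem sum_orderPerm (T : Ω → Ω) (χ g : Ω → ℝ) (n : ℕ) (x : Ω) :
    ∑ k : Fin n, g (T^[orderPerm T χ n x k] x) = birkhoffSum T g n x := by
  rw [Equiv.sum_comp (orderPerm T χ n x) (fun i : Fin n => g (T^[i] x)),
    Fin.sum_univ_eq_sum_range (fun i => g (T^[i] x)) n, birkhoffSum]

theorem apply_orderPerm_le (hb : birkhoffSum T (exceedance χ ℓ) n x ≤ b) {k : Fin n}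
    (hk : b ≤ (k : ℕ)) : χ (T^[orderPerm T χ n x k] x) ≤ ℓ := by
  by_contra! hlt
  have hcard : ((k : ℕ) : ℝ) + 1 ≤ b :=
    calc ((k : ℕ) : ℝ) + 1 = ∑ _j ∈ Finset.Iic k, (1 : ℝ) := by simp
      _ = ∑ j ∈ Finset.Iic k, exceedance χ ℓ (T^[orderPerm T χ n x j] x) :=
          Finset.sum_congr rfl fun j hj => (exceedance_of_lt
            (hlt.trans_le (antitone_orderPerm T χ n x (Finset.mem_Iic.1 hj)))).symm
      _ ≤ ∑ j, exceedance χ ℓ (T^[orderPerm T χ n x j] x) :=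
          Finset.sum_le_univ_sum_of_nonneg fun j => (exceedance_mem_Icc χ ℓ _).1
      _ ≤ b := by rwa [sum_orderPerm]
  have : (b : ℝ) ≤ (k : ℕ) := by exact_mod_cast hk
  linarith

theorem trimmedSum_add_sum_truncate (hb : birkhoffSum T (exceedance χ ℓ) n x ≤ b) :
    trimmedSum T χ n b x + ∑ k ∈ Finset.univ.filter (fun k : Fin n => ¬ b ≤ (k : ℕ)),
      truncate χ ℓ (T^[orderPerm T χ n x k] x) = birkhoffSum T (truncate χ ℓ) n x := by
  rw [← sum_orderPerm T χ, trimmedSum,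
    ← Finset.sum_filter_add_sum_filter_not Finset.univ fun k : Fin n => b ≤ (k : ℕ)]
  congr 1
  exact Finset.sum_congr rfl fun k hk =>
    (truncate_of_le (apply_orderPerm_le hb (Finset.mem_filter.1 hk).2)).symm

theorem sum_truncate_orderPerm_le (hℓ : 0 ≤ ℓ) (hb : birkhoffSum T (exceedance χ ℓ) n x ≤ b) :
    ∑ k ∈ Finset.univ.filter (fun k : Fin n => ¬ b ≤ (k : ℕ)),
        truncate χ ℓ (T^[orderPerm T χ n x k] x)
      ≤ (b - birkhoffSum T (exceedance χ ℓ) n x) * ℓ := by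
  have hcard : ((Finset.univ.filter fun k : Fin n => ¬ b ≤ (k : ℕ)).card : ℝ) ≤ b := by
    rw [Nat.cast_le]
    refine (Finset.card_le_card_of_injOn (fun k : Fin n => (k : ℕ)) (fun k hk => ?_)
      Fin.val_injective.injOn).trans_eq (Finset.card_range b)
    simpa using hk
  have hcount : ∑ k ∈ Finset.univ.filter (fun k : Fin n => ¬ b ≤ (k : ℕ)),
      exceedance χ ℓ (T^[orderPerm T χ n x k] x) = birkhoffSum T (exceedance χ ℓ) n x := by
    rw [← sum_orderPerm T χ]
    exact Finset.sum_filter_of_ne fun k _ hk hbk =>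
      hk (exceedance_of_le (apply_orderPerm_le hb hbk))
  refine (Finset.sum_le_sum fun k _ => truncate_le_sub_exceedance_mul χ ℓ _).trans ?_
  rw [Finset.sum_sub_distrib, Finset.sum_const, ← Finset.sum_mul, hcount, nsmul_eq_mul, sub_mul]
  gcongr

theorem trimmedSum_mem_Icc (h0 : ∀ x, 0 ≤ χ x) (hℓ : 0 ≤ ℓ)
    (hb : birkhoffSum T (exceedance χ ℓ) n x ≤ b) :
    trimmedSum T χ n b x ∈ Set.Icc
      (birkhoffSum T (truncate χ ℓ) n x - (b - birkhoffSum T (exceedance χ ℓ) n x) * ℓ)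
      (birkhoffSum T (truncate χ ℓ) n x) := by
  rw [← trimmedSum_add_sum_truncate hb]
  exact ⟨by linarith [sum_truncate_orderPerm_le hℓ hb],
    le_add_of_nonneg_right (Finset.sum_nonneg fun k _ => (truncate_mem_Icc h0 hℓ _).1)⟩

theorem tendsto_trimmedSum_div (h0 : ∀ x, 0 ≤ χ x) {f d : ℕ → ℝ} {b : ℕ → ℕ} (hf : ∀ n, 0 ≤ f n)
    (hd : ∀ᶠ n in atTop, 0 < d n)
    (hS : Tendsto (fun n => birkhoffSum T (truncate χ (f n)) n x / d n) atTop (𝓝 1))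
    (hb : ∀ᶠ n in atTop, birkhoffSum T (exceedance χ (f n)) n x ≤ b n)
    (hgap : Tendsto (fun n => f n / d n * (b n - birkhoffSum T (exceedance χ (f n)) n x))
      atTop (𝓝 0)) :
    Tendsto (fun n => trimmedSum T χ n (b n) x / d n) atTop (𝓝 1) := by
  refine tendsto_of_tendsto_of_tendsto_of_le_of_le' (by simpa using hS.sub hgap) hS ?_ ?_
  · filter_upwards [hd, hb] with n hdn hbn
    rw [div_mul_eq_mul_div, ← sub_div, mul_comm (f n)]
    exact div_le_div_of_nonneg_right (trimmedSum_mem_Icc h0 (hf n) hbn).1 hdn.le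
  · filter_upwards [hd, hb] with n hdn hbn
    exact div_le_div_of_nonneg_right (trimmedSum_mem_Icc h0 (hf n) hbn).2 hdn.le

end Trimming

section Fluctuation

variable {ε a L : ℝ}

/-- The normalization `max (a ^ (1/2 + ε) * L ^ (1/2 - ε)) L` of the theorem, which bounds the
fluctuations of a count with mean `a`; there `L = log log n`. -/
noncomputable def fluctuation (ε a L : ℝ) : ℝ :=
  max (a ^ (1 / 2 + ε) * L ^ (1 / 2 - ε)) L

theorem fluctuation_eq (hε : 0 ≤ ε) (ha : 0 ≤ a) (hL : 0 < L) :
    fluctuation ε a L = L * (max a L / L) ^ (1 / 2 + ε) := by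
  have hprod : a ^ (1 / 2 + ε) * L ^ (1 / 2 - ε) = L * (a / L) ^ (1 / 2 + ε) := by
    rw [show 1 / 2 - ε = 1 - (1 / 2 + ε) by ring, Real.rpow_sub hL, Real.rpow_one,
      Real.div_rpow ha hL.le]
    ring
  rw [fluctuation, hprod]
  rcases le_total a L with h | h
  · rw [max_eq_right h, div_self hL.ne', Real.one_rpow, mul_one, max_eq_right]
    exact mul_le_of_le_one_right hL.le
      (Real.rpow_le_one (by positivity) (div_le_one_of_le₀ h hL.le) (by positivity))
  · rw [max_eq_left h, max_eq_left]
    exact le_mul_of_one_le_right hL.le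
      (Real.one_le_rpow ((one_le_div hL).2 h) (by positivity))

theorem fluctuation_mono {a' L' : ℝ} (hε : 0 ≤ ε) (hε' : ε ≤ 1 / 2) (ha : 0 ≤ a) (haa' : a ≤ a')
    (hL : 0 ≤ L) (hLL' : L ≤ L') : fluctuation ε a L ≤ fluctuation ε a' L' := by
  have : 0 ≤ 1 / 2 - ε := by linarith
  have : 0 ≤ a' := ha.trans haa'
  unfold fluctuation
  gcongr

theorem fluctuation_mono_left {ε' : ℝ} (hε : 0 ≤ ε) (hεε' : ε ≤ ε') (ha : 0 ≤ a) (hL : 0 < L) :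
    fluctuation ε a L ≤ fluctuation ε' a L := by
  rw [fluctuation_eq hε ha hL, fluctuation_eq (hε.trans hεε') ha hL]
  gcongr
  exact (one_le_div hL).2 (le_max_right a L)

/-- With `x = max i Λ / Λ` the optimal parameter is of order `x ^ (ε - 1/2)`, which makes both terms
of the exponent multiples of `Λ * x ^ (2 * ε)`. -/
theorem exists_bernstein_exponent_le {t₀ C W i Λ V : ℝ} (ht₀ : 0 ≤ t₀) (hC : 0 ≤ C)
    (hW : 24 + 12 * C * t₀ ^ 2 ≤ t₀ * W) (hε : 0 ≤ ε) (hε' : ε ≤ 1 / 2) (hi : 0 ≤ i)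
    (hΛ : 1 ≤ Λ) (hV : V ≤ i + 2) :
    ∃ t ∈ Set.Icc 0 t₀, -(t * (W * fluctuation ε i Λ / 2) / 2) + C * t ^ 2 * V
      ≤ -(2 * Λ) - 4 * i ^ (2 * ε) := by
  have hΛ0 : 0 < Λ := by linarith
  set x := max i Λ / Λ
  have hx1 : 1 ≤ x := (one_le_div hΛ0).2 (le_max_right i Λ)
  have hΛx : Λ * x = max i Λ := mul_div_cancel₀ _ hΛ0.ne'
  set D := Λ * x ^ (2 * ε)
  have hΛD : Λ ≤ D := le_mul_of_one_le_right hΛ0.le (Real.one_le_rpow hx1 (by positivity))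
  have hiD : i ^ (2 * ε) ≤ D :=
    calc i ^ (2 * ε) ≤ (Λ * x) ^ (2 * ε) := by gcongr; exact hΛx ▸ le_max_left i Λ
      _ = Λ ^ (2 * ε) * x ^ (2 * ε) := Real.mul_rpow hΛ0.le (by positivity)
      _ ≤ Λ ^ (1 : ℝ) * x ^ (2 * ε) := by gcongr; linarith
      _ = D := by rw [Real.rpow_one]
  have hVx : V ≤ 3 * (Λ * x) := by
    rw [hΛx]
    linarith [le_max_left i Λ, le_max_right i Λ]
  have hfirst : x ^ (ε - 1 / 2) * fluctuation ε i Λ = D := by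
    rw [fluctuation_eq hε hi hΛ0, mul_left_comm, ← Real.rpow_add (by positivity)]
    congr 2
    ring
  have hsecond : (x ^ (ε - 1 / 2)) ^ 2 * (Λ * x) = D := by
    rw [mul_left_comm, ← Real.rpow_natCast, ← Real.rpow_mul (by positivity),
      ← Real.rpow_add_one (by positivity)]
    congr 2
    push_cast
    ring
  refine ⟨t₀ * x ^ (ε - 1 / 2), ⟨by positivity, mul_le_of_le_one_right ht₀
    (Real.rpow_le_one_of_one_le_of_nonpos hx1 (by linarith))⟩, ?_⟩
  calc -(t₀ * x ^ (ε - 1 / 2) * (W * fluctuation ε i Λ / 2) / 2)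
        + C * (t₀ * x ^ (ε - 1 / 2)) ^ 2 * V
      ≤ -(t₀ * x ^ (ε - 1 / 2) * (W * fluctuation ε i Λ / 2) / 2)
        + C * (t₀ * x ^ (ε - 1 / 2)) ^ 2 * (3 * (Λ * x)) := by gcongr
    _ = -(t₀ * W / 4) * (x ^ (ε - 1 / 2) * fluctuation ε i Λ)
        + 3 * C * t₀ ^ 2 * ((x ^ (ε - 1 / 2)) ^ 2 * (Λ * x)) := by ring
    _ = -((t₀ * W - 12 * C * t₀ ^ 2) / 4 * D) := by rw [hfirst, hsecond]; ring
    _ ≤ -(6 * D) := by gcongr; linarith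
    _ ≤ -(2 * Λ) - 4 * i ^ (2 * ε) := by linarith

end Fluctuation

section Cells

variable {p : ℕ → ℝ} {n n' : ℕ}

/-- The cell of `n` in the partition of the natural numbers used for the counts with means
`a n = n * p n`: within a cell `log n` and `a n` lie between consecutive integers, and `n` varies so
little that `n * p n'` changes by at most `1`. -/
noncomputable def countCell (p : ℕ → ℝ) (n : ℕ) : ℕ × ℕ × ℕ :=
  (⌊Real.log n⌋₊, ⌊n * p n⌋₊, ⌊n * (⌊n * p n⌋₊ + 1 : ℝ) / Real.exp ⌊Real.log n⌋₊⌋₊)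

theorem abs_sub_le_one_of_natFloor_eq {x y : ℝ} (hx : 0 ≤ x) (hy : 0 ≤ y) (h : ⌊x⌋₊ = ⌊y⌋₊) :
    |x - y| ≤ 1 := by
  have hfloor : (⌊x⌋₊ : ℝ) = ⌊y⌋₊ := congrArg _ h
  rw [abs_sub_le_iff]
  constructor <;>
  linarith [Nat.floor_le hx, Nat.floor_le hy, Nat.lt_floor_add_one x, Nat.lt_floor_add_one y]

theorem exp_natFloor_log_le (hn : n ≠ 0) : Real.exp ⌊Real.log n⌋₊ ≤ n := by
  rw [← Real.le_log_iff_exp_le (by positivity)]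
  exact Nat.floor_le (Real.log_natCast_nonneg n)

theorem natCast_lt_exp_natFloor_log_add_one (n : ℕ) : (n : ℝ) < Real.exp (⌊Real.log n⌋₊ + 1) := by
  rcases n.eq_zero_or_pos with rfl | hn
  · simpa using Real.exp_pos 1
  · rw [← Real.log_lt_iff_lt_exp (by positivity)]
    exact Nat.lt_floor_add_one _

theorem abs_mul_sub_mul_le_of_countCell_eq (hp : ∀ n, 0 ≤ p n) (hn' : n' ≠ 0)
    (h : countCell p n = countCell p n') : |n * p n' - n' * p n'| ≤ 1 := by
  simp only [countCell, Prod.mk.injEq] at h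
  obtain ⟨hk, hi, hj⟩ := h
  rw [hk, hi] at hj
  have hdist := abs_sub_le_one_of_natFloor_eq (by positivity) (by positivity) hj
  rw [← sub_div, ← sub_mul, abs_div, abs_mul, Real.abs_exp, div_le_one (Real.exp_pos _),
    abs_of_nonneg (by positivity : (0 : ℝ) ≤ ⌊n' * p n'⌋₊ + 1)] at hdist
  have hpos : (0 : ℝ) < n' := by positivity
  refine le_of_mul_le_mul_left (a := (n' : ℝ)) ?_ hpos
  calc n' * |n * p n' - n' * p n'| = |(n : ℝ) - n'| * (n' * p n') := by
        rw [← sub_mul, abs_mul, abs_of_nonneg (hp n')]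
        ring
    _ ≤ |(n : ℝ) - n'| * (⌊n' * p n'⌋₊ + 1) := by gcongr; exact (Nat.lt_floor_add_one _).le
    _ ≤ Real.exp ⌊Real.log n'⌋₊ := hdist
    _ ≤ n' * 1 := by rw [mul_one]; exact exp_natFloor_log_le hn'

theorem countCell_snd_snd_le (p : ℕ → ℝ) (n : ℕ) :
    (countCell p n).2.2 ≤ 3 * ((countCell p n).2.1 + 1) := by
  refine Nat.floor_le_of_le ?_
  rw [div_le_iff₀ (Real.exp_pos _)]
  push_cast
  have hn : (n : ℝ) ≤ 3 * Real.exp ⌊Real.log n⌋₊ := by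
    refine (natCast_lt_exp_natFloor_log_add_one n).le.trans ?_
    rw [Real.exp_add, mul_comm]
    gcongr
    exact Real.exp_one_lt_three.le
  calc (n : ℝ) * (⌊n * p n⌋₊ + 1) ≤ 3 * Real.exp ⌊Real.log n⌋₊ * (⌊n * p n⌋₊ + 1) := by gcongr
    _ = _ := by simp only [countCell]; ring

theorem finite_setOf_countCell_eq (p : ℕ → ℝ) (c : ℕ × ℕ × ℕ) : {n | countCell p n = c}.Finite := by
  refine (Set.finite_Iio ⌈Real.exp (c.1 + 1)⌉₊).subset fun n hn => Nat.lt_ceil.2 ?_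
  subst hn
  exact natCast_lt_exp_natFloor_log_add_one n

theorem tendsto_countCell_fst (p : ℕ → ℝ) : Tendsto (fun n => (countCell p n).1) atTop atTop :=
  tendsto_nat_floor_atTop.comp (Real.tendsto_log_atTop.comp tendsto_natCast_atTop_atTop)

theorem tendsto_countCell_cofinite (p : ℕ → ℝ) : Tendsto (countCell p) atTop cofinite := by
  refine .mono_right ?_ (comap_cofinite_le Prod.fst)
  rw [tendsto_comap_iff, Nat.cofinite_eq_atTop]
  exact tendsto_countCell_fst p

theorem summable_exp_neg_rpow {s : ℝ} (hs : 0 < s) :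
    Summable fun n : ℕ => Real.exp (-(n : ℝ) ^ s) := by
  have hpow : Tendsto (fun n : ℕ => (n : ℝ) ^ s) atTop atTop :=
    (tendsto_rpow_atTop hs).comp tendsto_natCast_atTop_atTop
  have hexp := ((isLittleO_exp_neg_mul_rpow_atTop one_pos (-2 / s)).comp_tendsto hpow).isBigO
  refine summable_of_isBigO_nat (g := fun n : ℕ => (n : ℝ) ^ (-2 : ℝ))
    (Real.summable_nat_rpow.2 (by norm_num)) ((hexp.congr_left fun n => ?_).congr_right fun n => ?_)
  · rw [Function.comp_apply, neg_one_mul]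
  · rw [Function.comp_apply, ← Real.rpow_mul n.cast_nonneg, mul_div_cancel₀ _ hs.ne']

/-- A summable family of weights which dominates the probabilities of exceptional fluctuations in
the cells, up to a constant. -/
noncomputable def cellWeight (ε : ℝ) (c : ℕ × ℕ × ℕ) : ℝ :=
  ((c.1 : ℝ) ^ 2)⁻¹ * (Real.exp (-(c.2.1 : ℝ) ^ (2 * ε)) * Real.exp (-(c.2.2 : ℝ) ^ (2 * ε)))

theorem summable_cellWeight {ε : ℝ} (hε : 0 < ε) : Summable (cellWeight ε) := by
  have hexp := summable_exp_neg_rpow (mul_pos two_pos hε)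
  exact (Real.summable_nat_pow_inv.2 one_lt_two).mul_of_nonneg
    (hexp.mul_of_nonneg hexp (fun _ => (Real.exp_pos _).le) fun _ => (Real.exp_pos _).le)
    (fun _ => by positivity) fun _ => by positivity

theorem exp_le_cellWeight {ε : ℝ} (hε : 0 ≤ ε) (hε' : ε ≤ 1 / 2) {k i j : ℕ} (hk : k ≠ 0)
    (hj : j ≤ 3 * (i + 1)) :
    Real.exp (-(2 * Real.log k) - 4 * (i : ℝ) ^ (2 * ε)) ≤ Real.exp 3 * cellWeight ε (k, i, j) := by
  have hrpow : (j : ℝ) ^ (2 * ε) ≤ 3 * ((i : ℝ) ^ (2 * ε) + 1) :=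
    calc (j : ℝ) ^ (2 * ε) ≤ (3 * ((i : ℝ) + 1)) ^ (2 * ε) := by gcongr; exact_mod_cast hj
      _ = 3 ^ (2 * ε) * ((i : ℝ) + 1) ^ (2 * ε) := Real.mul_rpow (by positivity) (by positivity)
      _ ≤ 3 ^ (1 : ℝ) * ((i : ℝ) ^ (2 * ε) + 1 ^ (2 * ε)) := by
          gcongr
          · norm_num
          · linarith
          · exact Real.rpow_add_le_add_rpow (by positivity) (by positivity) (by positivity)
              (by linarith)
      _ = 3 * ((i : ℝ) ^ (2 * ε) + 1) := by rw [Real.rpow_one, Real.one_rpow]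
  have hsq : ((k : ℝ) ^ 2)⁻¹ = Real.exp (-(2 * Real.log k)) := by
    rw [Real.exp_neg, two_mul, Real.exp_add, Real.exp_log (by positivity), pow_two]
  rw [cellWeight, hsq, ← Real.exp_add, ← Real.exp_add, ← Real.exp_add, Real.exp_le_exp]
  linarith

end Cells

section Counts

variable {Ω : Type*} {T : Ω → Ω} {χ : Ω → ℝ}

theorem birkhoffSum_exceedance_le {n n' : ℕ} (hn : n ≤ n') {ℓ ℓ' : ℝ} (hℓ : ℓ' ≤ ℓ) (x : Ω) :
    birkhoffSum T (exceedance χ ℓ) n x ≤ birkhoffSum T (exceedance χ ℓ') n' x :=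
  Finset.sum_le_sum_of_subset_of_nonneg (Finset.range_mono hn)
    (fun _ _ _ => (exceedance_mem_Icc χ ℓ' _).1) |>.trans' <|
    Finset.sum_le_sum fun _ _ => antitone_exceedance χ hℓ _

variable [MeasurableSpace Ω] {μ : Measure Ω}

/-- The counts increase with `n` and decrease with the threshold, so the deviations of all counts
in `A` are controlled by two of them, taken at the extremal times and thresholds in `A`. -/
theorem measureReal_exists_mem_le [IsFiniteMeasure μ] {A : Set ℕ} (hA : A.Finite)
    {f p : ℕ → ℝ} {c v w β : ℝ} (hβ : 0 ≤ β)
    (hmean : ∀ n ∈ A, ∀ n' ∈ A, |n * p n' - c| ≤ w)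
    (htail : ∀ n ∈ A, ∀ n' ∈ A,
      μ.real {x | v ≤ |birkhoffSum T (exceedance χ (f n')) n x - n * p n'|} ≤ β) :
    μ.real {x | ∃ n ∈ A, v + 2 * w ≤ |birkhoffSum T (exceedance χ (f n)) n x - n * p n|}
      ≤ 2 * β := by
  rcases A.eq_empty_or_nonempty with rfl | hne
  · simpa using hβ
  obtain ⟨nmin, hnmin, hnmin_le⟩ := A.exists_min_image id hA hne
  obtain ⟨nmax, hnmax, hnmax_le⟩ := A.exists_max_image id hA hne
  obtain ⟨mmin, hmmin, hmmin_le⟩ := A.exists_min_image f hA hne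
  obtain ⟨mmax, hmmax, hmmax_le⟩ := A.exists_max_image f hA hne
  let s (n n' : ℕ) : Set Ω := {x | v ≤ |birkhoffSum T (exceedance χ (f n')) n x - n * p n'|}
  have hsub : {x | ∃ n ∈ A, v + 2 * w ≤ |birkhoffSum T (exceedance χ (f n)) n x - n * p n|} ⊆
      s nmax mmin ∪ s nmin mmax := by
    rintro x ⟨n, hn, hx⟩
    have hn_mean := abs_le.1 (hmean n hn n hn)
    rcases le_abs.1 hx with hx | hx
    · refine .inl (show v ≤ |_| from le_abs.2 (.inl ?_))
      have hle := birkhoffSum_exceedance_le (T := T) (χ := χ) (n := n) (n' := nmax)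
        (hnmax_le n hn) (hmmin_le n hn) x
      linarith [abs_le.1 (hmean nmax hnmax mmin hmmin)]
    · refine .inr (show v ≤ |_| from le_abs.2 (.inr ?_))
      have hle := birkhoffSum_exceedance_le (T := T) (χ := χ) (n := nmin) (n' := n)
        (hnmin_le n hn) (hmmax_le n hn) x
      linarith [abs_le.1 (hmean nmin hnmin mmax hmmax)]
  calc μ.real _ ≤ μ.real (s nmax mmin ∪ s nmin mmax) := measureReal_mono hsub
    _ ≤ μ.real (s nmax mmin) + μ.real (s nmin mmax) := measureReal_union_le _ _
    _ ≤ β + β := add_le_add (htail _ hnmax _ hmmin) (htail _ hnmin _ hmmax)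
    _ = 2 * β := (two_mul β).symm

variable {f p : ℕ → ℝ} {ε t₀ C W : ℝ}

theorem fluctuation_countCell_le (hε : 0 ≤ ε) (hε' : ε ≤ 1 / 2) (hp : ∀ n, 0 ≤ p n) {n : ℕ}
    (hn : 3 ≤ (countCell p n).1) :
    fluctuation ε (countCell p n).2.1 (Real.log (countCell p n).1) ≤
      fluctuation ε (n * p n) (Real.log (Real.log n)) := by
  have hk : (1 : ℝ) ≤ (countCell p n).1 := by exact_mod_cast (by lia : 1 ≤ (countCell p n).1)
  exact fluctuation_mono hε hε' (Nat.cast_nonneg _)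
    (Nat.floor_le (mul_nonneg n.cast_nonneg (hp n))) (Real.log_nonneg hk)
    (Real.log_le_log (by linarith) (Nat.floor_le (Real.log_natCast_nonneg n)))

theorem abs_mul_sub_countCell_le (hp : ∀ n, 0 ≤ p n) {n n' : ℕ} (hn' : n' ≠ 0)
    (h : countCell p n = countCell p n') : |n * p n' - (countCell p n').2.1| ≤ 2 := by
  have hfloor : |n' * p n' - (countCell p n').2.1| ≤ 1 := by
    refine abs_sub_le_one_of_natFloor_eq (mul_nonneg n'.cast_nonneg (hp n')) (Nat.cast_nonneg _) ?_
    rw [Nat.floor_natCast]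
    rfl
  calc |n * p n' - (countCell p n').2.1|
      ≤ |n * p n' - n' * p n'| + |n' * p n' - (countCell p n').2.1| := abs_sub_le _ _ _
    _ ≤ 1 + 1 := add_le_add (abs_mul_sub_mul_le_of_countCell_eq hp hn' h) hfloor
    _ = 2 := one_add_one_eq_two

theorem one_le_log_natCast {k : ℕ} (hk : 3 ≤ k) : 1 ≤ Real.log k := by
  have hk3 : (3 : ℝ) ≤ k := by exact_mod_cast hk
  rw [Real.le_log_iff_exp_le (by linarith)]
  exact Real.exp_one_lt_three.le.trans hk3

theorem BernsteinBound.measureReal_le_cellWeight {G : Ω → ℝ} (hB : BernsteinBound T μ G t₀ C)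
    (ht₀ : 0 ≤ t₀) (hC : 0 ≤ C) (hW0 : 0 ≤ W) (hW : 24 + 12 * C * t₀ ^ 2 ≤ t₀ * W) (hε : 0 ≤ ε)
    (hε' : ε ≤ 1 / 2) {c : ℕ × ℕ × ℕ} (hc : 3 ≤ c.1) (hc' : c.2.2 ≤ 3 * (c.2.1 + 1)) {n : ℕ}
    (hmean : n * ∫ x, G x ∂μ ≤ c.2.1 + 2) :
    μ.real {x | W * fluctuation ε c.2.1 (Real.log c.1) / 2
        ≤ |birkhoffSum T G n x - n * ∫ x, G x ∂μ|}
      ≤ 2 * (Real.exp 3 * cellWeight ε c) := by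
  have hΛ := one_le_log_natCast hc
  have hφ : 0 ≤ fluctuation ε c.2.1 (Real.log c.1) :=
    (zero_le_one.trans hΛ).trans (le_max_right _ _)
  obtain ⟨t, ht, hexp⟩ :=
    exists_bernstein_exponent_le ht₀ hC hW hε hε' c.2.1.cast_nonneg hΛ hmean
  refine (hB t ht n _ (by positivity)).trans ?_
  gcongr
  exact (Real.exp_le_exp.2 hexp).trans (exp_le_cellWeight hε hε' (by lia) hc')

theorem measureReal_countCell_le [IsFiniteMeasure μ] (ht₀ : 0 ≤ t₀) (hC : 0 ≤ C) (hW8 : 8 ≤ W)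
    (hW : 24 + 12 * C * t₀ ^ 2 ≤ t₀ * W) (hε : 0 ≤ ε) (hε' : ε ≤ 1 / 2)
    (hB : ∀ n, BernsteinBound T μ (exceedance χ (f n)) t₀ C)
    (hp : ∀ n, ∫ x, exceedance χ (f n) x ∂μ = p n) {m : ℕ} (hm : 3 ≤ (countCell p m).1) :
    μ.real {x | ∃ n ∈ {n | countCell p n = countCell p m},
        W * fluctuation ε (n * p n) (Real.log (Real.log n))
          ≤ |birkhoffSum T (exceedance χ (f n)) n x - n * p n|}
      ≤ 4 * Real.exp 3 * cellWeight ε (countCell p m) := by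
  have hp0 (n : ℕ) : 0 ≤ p n :=
    hp n ▸ integral_nonneg fun y => (exceedance_mem_Icc χ (f n) y).1
  generalize hc : countCell p m = c at hm ⊢
  set φ := fluctuation ε c.2.1 (Real.log c.1)
  have hφ : 8 ≤ W * φ := by
    have hφ1 : 1 ≤ φ := (one_le_log_natCast hm).trans (le_max_right _ _)
    nlinarith
  have hmean : ∀ n ∈ {n | countCell p n = c}, ∀ n' ∈ {n | countCell p n = c},
      |n * p n' - c.2.1| ≤ 2 := by
    rintro n hn n' rfl
    refine abs_mul_sub_countCell_le hp0 ?_ hn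
    rintro rfl
    simp [countCell] at hm
  have htail : ∀ n ∈ {n | countCell p n = c}, ∀ n' ∈ {n | countCell p n = c},
      μ.real {x | W * φ / 2 ≤ |birkhoffSum T (exceedance χ (f n')) n x - n * p n'|}
        ≤ 2 * (Real.exp 3 * cellWeight ε c) := by
    intro n hn n' hn'
    rw [← hp n']
    refine (hB n').measureReal_le_cellWeight ht₀ hC (by linarith) hW hε hε' hm
      (hc ▸ countCell_snd_snd_le p m) ?_
    rw [hp n']
    exact sub_le_iff_le_add'.1 (abs_le.1 (hmean n hn n' hn')).2
  calc μ.real _ ≤ μ.real {x | ∃ n ∈ {n | countCell p n = c},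
        W * φ / 2 + 2 * 2 ≤ |birkhoffSum T (exceedance χ (f n)) n x - n * p n|} := by
        refine measureReal_mono ?_
        rintro x ⟨n, rfl, hx⟩
        refine ⟨n, rfl, le_trans ?_ hx⟩
        have hle := mul_le_mul_of_nonneg_left (fluctuation_countCell_le hε hε' hp0 hm)
          (by linarith : 0 ≤ W)
        linarith
    _ ≤ 2 * (2 * (Real.exp 3 * cellWeight ε c)) := by
        refine measureReal_exists_mem_le (finite_setOf_countCell_eq p c) ?_ hmean htail
        unfold cellWeight
        positivity
    _ = 4 * Real.exp 3 * cellWeight ε c := by ring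

theorem ae_eventually_abs_birkhoffSum_exceedance_sub_lt [IsFiniteMeasure μ] (ht₀ : 0 ≤ t₀)
    (hC : 0 ≤ C) (hW8 : 8 ≤ W) (hW : 24 + 12 * C * t₀ ^ 2 ≤ t₀ * W) (hε : 0 < ε) (hε' : ε ≤ 1 / 2)
    (hB : ∀ n, BernsteinBound T μ (exceedance χ (f n)) t₀ C)
    (hp : ∀ n, ∫ x, exceedance χ (f n) x ∂μ = p n) :
    ∀ᵐ x ∂μ, ∀ᶠ n : ℕ in atTop, |birkhoffSum T (exceedance χ (f n)) n x - n * p n| <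
      W * fluctuation ε (n * p n) (Real.log (Real.log n)) := by
  let s (c : ℕ × ℕ × ℕ) : Set Ω := {x | 3 ≤ c.1 ∧ ∃ n ∈ {n | countCell p n = c},
    W * fluctuation ε (n * p n) (Real.log (Real.log n))
      ≤ |birkhoffSum T (exceedance χ (f n)) n x - n * p n|}
  have hs (c : ℕ × ℕ × ℕ) : μ.real (s c) ≤ 4 * Real.exp 3 * cellWeight ε c := by
    by_cases hc : 3 ≤ c.1 ∧ ∃ m, countCell p m = c
    · obtain ⟨hm, m, rfl⟩ := hc
      exact (measureReal_mono fun x hx => hx.2).trans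
        (measureReal_countCell_le ht₀ hC hW8 hW hε.le hε' hB hp hm)
    · have hempty : s c = ∅ :=
        Set.eq_empty_of_forall_notMem fun x ⟨hk, n, hn, _⟩ => hc ⟨hk, n, hn⟩
      rw [hempty, measureReal_empty, cellWeight]
      positivity
  have hBC := ae_eventually_notMem_of_summable ((summable_cellWeight hε).mul_left _)
    (Eventually.of_forall hs)
  filter_upwards [hBC] with x hx
  filter_upwards [(tendsto_countCell_cofinite p).eventually hx,
    (tendsto_countCell_fst p).eventually_ge_atTop 3] with n hn hn3
  by_contra! hbad
  exact hn ⟨hn3, n, rfl, hbad⟩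

theorem exists_ae_eventually_abs_birkhoffSum_exceedance_sub_lt [IsProbabilityMeasure μ]
    (hχ : Measurable χ) (ht₀ : 0 < t₀) (hC : 0 ≤ C)
    (hB : ∀ ℓ, 0 < ℓ → BernsteinBound T μ (exceedance χ ℓ) t₀ C) :
    ∃ W, 0 < W ∧ ∀ (ε : ℝ) (f : ℕ → ℝ), 0 < ε → (∀ n, 0 < f n) →
      ∀ᵐ x ∂μ, ∀ᶠ n : ℕ in atTop,
        |birkhoffSum T (exceedance χ (f n)) n x - aSeq μ χ f n| <
          W * fluctuation ε (aSeq μ χ f n) (Real.log (Real.log n)) := by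
  have hW : 24 + 12 * C * t₀ ^ 2 ≤ t₀ * ((24 + 12 * C * t₀ ^ 2) / t₀ + 8) := by
    rw [mul_add, mul_div_cancel₀ _ ht₀.ne']
    linarith
  refine ⟨(24 + 12 * C * t₀ ^ 2) / t₀ + 8, by positivity, fun ε f hε hf => ?_⟩
  have hloglog : Tendsto (fun n : ℕ => Real.log (Real.log n)) atTop atTop :=
    Real.tendsto_log_atTop.comp (Real.tendsto_log_atTop.comp tendsto_natCast_atTop_atTop)
  filter_upwards [ae_eventually_abs_birkhoffSum_exceedance_sub_lt ht₀.le hC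
    (le_add_of_nonneg_left (by positivity)) hW (lt_min hε one_half_pos) (min_le_right ε (1 / 2))
    (fun n => hB (f n) (hf n)) fun _ => rfl] with x hx
  filter_upwards [hx, hloglog.eventually_gt_atTop 0] with n hn hL
  rw [mul_integral_exceedance hχ f n] at hn
  refine hn.trans_le ?_
  gcongr
  exact fluctuation_mono_left (by positivity) (min_le_left ε (1 / 2)) (aSeq_nonneg f n) hL

end Counts

section TrimmingNumber

theorem sub_mem_Icc_of_abs_sub_lt {N a u : ℝ} {b : ℕ} (ha : 0 ≤ a) (hN : |N - a| < u)
    (hb : b = ⌈a + u⌉₊) : b - N ∈ Set.Icc 0 (2 * u + 1) := by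
  have hle : a + u ≤ b := hb ▸ Nat.le_ceil _
  have hlt : b < a + u + 1 := hb ▸ Nat.ceil_lt_add_one (add_nonneg ha ((abs_nonneg _).trans hN.le))
  have habs := abs_lt.1 hN
  constructor <;> linarith

theorem tendsto_mul_zero_of_mem_Icc {r L M : ℕ → ℝ} (hr : ∀ᶠ n in atTop, 0 ≤ r n)
    (hL : ∀ᶠ n in atTop, L n ∈ Set.Icc 0 (M n))
    (hlim : Tendsto (fun n => r n * M n) atTop (𝓝 0)) :
    Tendsto (fun n => r n * L n) atTop (𝓝 0) := by
  refine squeeze_zero' ?_ ?_ hlim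
  · filter_upwards [hr, hL] with n hrn hLn using mul_nonneg hrn hLn.1
  · filter_upwards [hr, hL] with n hrn hLn using mul_le_mul_of_nonneg_left hLn.2 hrn

end TrimmingNumber

section TrimmedSums

variable {Ω : Type*} [MeasurableSpace Ω] {T : Ω → Ω} {μ : Measure Ω} {χ : Ω → ℝ}

theorem ae_tendsto_trimmedSum_div (h0 : ∀ x, 0 ≤ χ x) {ε W : ℝ} (hW : 0 ≤ W) {f : ℕ → ℝ}
    (hf : ∀ n, 0 < f n) (hd : ∀ᶠ n in atTop, 0 < dSeq μ χ f n)
    (hlim : Tendsto (fun n : ℕ => f n / dSeq μ χ f n *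
      max (aSeq μ χ f n ^ (1 / 2 + ε) * Real.log (Real.log n) ^ (1 / 2 - ε)) (Real.log n))
      atTop (𝓝 0))
    (hS : ∀ᵐ x ∂μ, Tendsto (fun n => birkhoffSum T (truncate χ (f n)) n x / dSeq μ χ f n)
      atTop (𝓝 1))
    (hN : ∀ᵐ x ∂μ, ∀ᶠ n : ℕ in atTop,
      |birkhoffSum T (exceedance χ (f n)) n x - aSeq μ χ f n| <
        W * fluctuation ε (aSeq μ χ f n) (Real.log (Real.log n)))
    {b : ℕ → ℕ} (hb : ∀ n : ℕ, b n =
      ⌈aSeq μ χ f n + W * fluctuation ε (aSeq μ χ f n) (Real.log (Real.log n))⌉₊) :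
    ∀ᵐ x ∂μ, Tendsto (fun n => trimmedSum T χ n (b n) x / dSeq μ χ f n) atTop (𝓝 1) := by
  have hlog : ∀ᶠ n : ℕ in atTop, 1 ≤ Real.log n :=
    (Real.tendsto_log_atTop.comp tendsto_natCast_atTop_atTop).eventually_ge_atTop 1
  filter_upwards [hS, hN] with x hSx hNx
  have hb' := hNx.mono fun n hn => sub_mem_Icc_of_abs_sub_lt (aSeq_nonneg f n) hn (hb n)
  refine tendsto_trimmedSum_div h0 (fun n => (hf n).le) hd hSx
    (hb'.mono fun n hn => sub_nonneg.1 hn.1)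
    (tendsto_mul_zero_of_mem_Icc (hd.mono fun n hn => (div_pos (hf n) hn).le) ?_
      (by simpa only [mul_zero, mul_left_comm] using hlim.const_mul (2 * W + 1)))
  filter_upwards [hb', hlog] with n hbn hn
  set A := aSeq μ χ f n ^ (1 / 2 + ε) * Real.log (Real.log n) ^ (1 / 2 - ε)
  have hφ : fluctuation ε (aSeq μ χ f n) (Real.log (Real.log n)) ≤ max A (Real.log n) :=
    max_le_max_left _ (Real.log_le_self (zero_le_one.trans hn))
  refine ⟨hbn.1, hbn.2.trans ?_⟩
  calc 2 * (W * fluctuation ε (aSeq μ χ f n) (Real.log (Real.log n))) + 1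
      ≤ 2 * (W * max A (Real.log n)) + max A (Real.log n) := by
        gcongr
        exact hn.trans (le_max_right _ _)
    _ = (2 * W + 1) * max A (Real.log n) := by ring

variable [IsProbabilityMeasure μ]

theorem ae_tendsto_birkhoffSum_truncate_div (hχ : Measurable χ) (h0 : ∀ x, 0 ≤ χ x) {t₀ C : ℝ}
    (ht₀ : 0 < t₀) (hC : 0 < C)
    (hB : ∀ ℓ, 0 < ℓ → BernsteinBound T μ (fun x => ℓ⁻¹ * truncate χ ℓ x) t₀ C) {f : ℕ → ℝ}
    (hf : ∀ n, 0 < f n) (hd : ∀ᶠ n in atTop, 0 < dSeq μ χ f n)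
    (hlog : Tendsto (fun n => f n / dSeq μ χ f n * Real.log n) atTop (𝓝 0)) :
    ∀ᵐ x ∂μ, Tendsto (fun n => birkhoffSum T (truncate χ (f n)) n x / dSeq μ χ f n)
      atTop (𝓝 1) := by
  have hmean (n : ℕ) : n * ∫ x, (f n)⁻¹ * truncate χ (f n) x ∂μ = (f n)⁻¹ * dSeq μ χ f n := by
    rw [integral_const_mul, mul_left_comm, mul_integral_truncate hχ h0]
  have hslln := ae_tendsto_birkhoffSum_div ht₀ hC (fun n => hB (f n) (hf n)) ?_ ?_
  · filter_upwards [hslln] with x hx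
    refine hx.congr fun n => ?_
    rw [hmean, birkhoffSum, ← Finset.mul_sum, mul_div_mul_left _ _ (inv_ne_zero (hf n).ne')]
    rfl
  · filter_upwards [hd] with n hdn
    rw [hmean]
    exact mul_pos (inv_pos.2 (hf n)) hdn
  · refine hlog.congr fun n => ?_
    rw [hmean, inv_mul_eq_div, div_div_eq_mul_div, div_mul_eq_mul_div, mul_comm]

end TrimmedSums

section Main

variable {Ω : Type*} [MeasurableSpace Ω] {T : Ω → Ω} {μ : Measure Ω} {χ : Ω → ℝ}
  {F : Type*} [NormedCommRing F] [NormedAlgebra ℂ F] {ι : F →ₗ[ℂ] (Ω →ₘ[μ] ℂ)}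

theorem represents_exceedance {ℓ : ℝ} {h : F}
    (hh : ∀ᵐ x ∂μ, ι h x = {y | ℓ < χ y}.indicator (fun _ => (1 : ℂ)) x) :
    Represents ι h (exceedance χ ℓ) := by
  filter_upwards [hh] with x hx
  rw [hx, exceedance]
  by_cases hχx : ℓ < χ x <;> simp [hχx]

variable [IsProbabilityMeasure μ] [CompleteSpace F] {U : F →L[ℂ] F}

theorem IsTransferOn.exists_bernsteinBound_truncate (hU : IsTransferOn T ι U)
    (hι : IsFunctionAlgebra μ ι) (hT : MeasurePreserving T μ μ) (hgap : HasSpectralGap U)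
    (h0 : ∀ x, 0 ≤ χ x) {K : ℝ} (hK : 0 ≤ K)
    (hχK : ∀ ℓ : ℝ, 0 < ℓ → ∃ h : F, Represents ι h (truncate χ ℓ) ∧ ‖h‖ ≤ K * ℓ) :
    ∃ t₀ C : ℝ, 0 < t₀ ∧ 0 < C ∧
      ∀ ℓ : ℝ, 0 < ℓ → BernsteinBound T μ (fun x => ℓ⁻¹ * truncate χ ℓ x) t₀ C := by
  obtain ⟨t₀, C, ht₀, hC, hB⟩ := hU.exists_bernsteinBound hι hT hgap hK
  refine ⟨t₀, C, ht₀, hC, fun ℓ hℓ => ?_⟩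
  obtain ⟨h, hh, hhK⟩ := hχK ℓ hℓ
  refine hB _ _ (fun x => ?_) (hh.const_smul ℓ⁻¹) ?_
  · obtain ⟨hlo, hhi⟩ := truncate_mem_Icc h0 hℓ.le x
    exact ⟨by positivity, by rwa [inv_mul_le_one₀ hℓ]⟩
  · rw [norm_smul, Complex.norm_of_nonneg (by positivity), inv_mul_le_iff₀ hℓ, mul_comm]
    exact hhK

theorem IsTransferOn.exists_bernsteinBound_exceedance (hU : IsTransferOn T ι U)
    (hι : IsFunctionAlgebra μ ι) (hT : MeasurePreserving T μ μ) (hgap : HasSpectralGap U)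
    {K : ℝ} (hK : 0 ≤ K)
    (hχK : ∀ ℓ : ℝ, 0 < ℓ → ∃ h : F, Represents ι h (exceedance χ ℓ) ∧ ‖h‖ ≤ K) :
    ∃ t₀ C : ℝ, 0 < t₀ ∧ 0 < C ∧
      ∀ ℓ : ℝ, 0 < ℓ → BernsteinBound T μ (exceedance χ ℓ) t₀ C := by
  obtain ⟨t₀, C, ht₀, hC, hB⟩ := hU.exists_bernsteinBound hι hT hgap hK
  refine ⟨t₀, C, ht₀, hC, fun ℓ hℓ => ?_⟩
  obtain ⟨h, hh, hhK⟩ := hχK ℓ hℓ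
  exact hB _ h (exceedance_mem_Icc χ ℓ) hh hhK

end Main

theorem theorem1p2_general {Ω : Type*} [MeasurableSpace Ω] {T : Ω → Ω} {μ : Measure Ω}
    [IsProbabilityMeasure μ] {F : Type*} [NormedCommRing F] [NormedAlgebra ℂ F] [CompleteSpace F]
    {ι : F →ₗ[ℂ] (Ω →ₘ[μ] ℂ)} {U : F →L[ℂ] F} {χ : Ω → ℝ} (hι : IsFunctionAlgebra μ ι)
    (hT : MeasurePreserving T μ μ) (hU : IsTransferOn T ι U) (hgap : HasSpectralGap U)
    (hχ : Measurable χ) (h0 : ∀ x, 0 ≤ χ x)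
    (htruncate : ∃ K₁ : ℝ, 0 < K₁ ∧ ∀ ℓ : ℝ, 0 < ℓ →
      ∃ h : F, Represents ι h (truncate χ ℓ) ∧ ‖h‖ ≤ K₁ * ℓ)
    (hexceedance : ∃ K₂ : ℝ, 0 < K₂ ∧ ∀ ℓ : ℝ, 0 < ℓ →
      ∃ h : F, Represents ι h (exceedance χ ℓ) ∧ ‖h‖ ≤ K₂) :
    ∃ W : ℝ, 0 < W ∧
      ∀ (ε : ℝ) (f : ℕ → ℝ), 0 < ε → (∀ n, 0 < f n) →
        (∀ᶠ n in atTop, 0 < dSeq μ χ f n) →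
        Tendsto (fun n : ℕ => f n / dSeq μ χ f n *
          max (aSeq μ χ f n ^ (1 / 2 + ε) * Real.log (Real.log n) ^ (1 / 2 - ε))
            (Real.log n)) atTop (𝓝 0) →
        ∀ b : ℕ → ℕ,
          (∀ n : ℕ, b n = ⌈aSeq μ χ f n +
            W * max (aSeq μ χ f n ^ (1 / 2 + ε) * Real.log (Real.log n) ^ (1 / 2 - ε))
              (Real.log (Real.log n))⌉₊) →
          ∀ᵐ x ∂μ, Tendsto (fun n : ℕ => trimmedSum T χ n (b n) x / dSeq μ χ f n)
            atTop (𝓝 1) := by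
  obtain ⟨K₁, hK₁, htruncate⟩ := htruncate
  obtain ⟨K₂, hK₂, hexceedance⟩ := hexceedance
  obtain ⟨t₁, C₁, ht₁, hC₁, hB₁⟩ :=
    hU.exists_bernsteinBound_truncate hι hT hgap h0 hK₁.le htruncate
  obtain ⟨t₂, C₂, ht₂, hC₂, hB₂⟩ :=
    hU.exists_bernsteinBound_exceedance hι hT hgap hK₂.le hexceedance
  obtain ⟨W, hW, hcount⟩ :=
    exists_ae_eventually_abs_birkhoffSum_exceedance_sub_lt hχ ht₂ hC₂.le hB₂
  refine ⟨W, hW, fun ε f hε hf hd hlim b hb => ?_⟩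
  refine ae_tendsto_trimmedSum_div h0 hW.le hf hd hlim ?_ (hcount ε f hε hf) hb
  refine ae_tendsto_birkhoffSum_truncate_div hχ h0 ht₁ hC₁ hB₁ hf hd ?_
  exact tendsto_mul_zero_of_mem_Icc (hd.mono fun n hn => (div_pos (hf n) hn).le)
    (.of_forall fun n => ⟨Real.log_natCast_nonneg n, le_max_right _ _⟩) hlim

theorem theorem1p2 {Ω : Type*} [MeasurableSpace Ω] (T : Ω → Ω) (μ : Measure Ω)
    [IsProbabilityMeasure μ]
    {F : Type*} [NormedCommRing F] [NormedAlgebra ℂ F] [CompleteSpace F]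
    (ι : F →ₗ[ℂ] (Ω →ₘ[μ] ℂ)) (χ : Ω → ℝ) (hD : PropertyD T μ ι χ) :
    ∃ W : ℝ, 0 < W ∧
      ∀ (ε : ℝ) (f : ℕ → ℝ), 0 < ε → ε < 1 / 4 →
        (∀ n, 0 < f n) → Tendsto f atTop atTop →
        (∀ᶠ n in atTop, 0 < dSeq μ χ f n) →
        Tendsto (fun n : ℕ => f n / dSeq μ χ f n *
          max (aSeq μ χ f n ^ (1 / 2 + ε) * Real.log (Real.log n) ^ (1 / 2 - ε))
            (Real.log n)) atTop (𝓝 0) →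
        ∀ b : ℕ → ℕ,
          (∀ n : ℕ, b n = ⌈aSeq μ χ f n +
            W * max (aSeq μ χ f n ^ (1 / 2 + ε) * Real.log (Real.log n) ^ (1 / 2 - ε))
              (Real.log (Real.log n))⌉₊) →
          ∀ᵐ x ∂μ, Tendsto (fun n : ℕ => trimmedSum T χ n (b n) x / dSeq μ χ f n)
            atTop (𝓝 1) := by
  obtain ⟨That, hThat, U, hU, hgap⟩ := hD.propertyC.transfer
  obtain ⟨K₂, hK₂, hindicator⟩ := hD.norm_indicator_le
  obtain ⟨W, hW, hmain⟩ := theorem1p2_general hD.propertyC.isFunctionAlgebra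
    hD.propertyC.measurePreserving (hThat.isTransferOn hD.propertyC.isFunctionAlgebra hU) hgap
    hD.measurable hD.nonneg hD.norm_truncate_le ⟨K₂, hK₂, fun ℓ hℓ =>
      (hindicator ℓ hℓ).imp fun _ hh => hh.imp_left represents_exceedance⟩
  exact ⟨W, hW, fun ε f hε _ hf _ => hmain ε f hε hf⟩
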